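/- Let $R$ be an artin algebra, i.e. an algebra over a commutative artinian ring $k$ that is finitely generated as a $k$-module. Let $\mathrm{mod}\,R$ be the category of finitely generated left $R$-modules, $\mathcal D=\mathcal D^b(\mathrm{mod}\,R)$ its bounded derived category (cochain complexes), and $\mathcal K^b(\mathcal P_R)$ the full subcategory of $\mathcal D$ of objects isomorphic to bounded complexes of finitely generated projective modules; objects of $\mathcal K^b(\mathcal P_R)$ are called compact. For integers $a,b$ let $\mathcal D^{[a,b]}$ be the class of complexes whose cohomology is concentrated in degrees in $[a,b]$, and for $T\in\mathcal D$ let $\mathrm{add}_{\mathcal D}T$ be the class of direct summands of finite direct sums of copies of $T$, and ${}^{\perp_{k>0}}T=\{X\in\mathcal D\mid \mathrm{Hom}_{\mathcal D}(X,T[k])=0 \text{ for all } k>0\}$. A complex $T\in\mathcal D$ is semi-selforthogonal if $\mathrm{Hom}_{\mathcal D}(T,T[k])=0$ for all $k>0$. It is silting if $T\in\mathcal K^b(\mathcal P_R)$, $T$ is semi-selforthogonal, and $T$ generates $\mathcal K^b(\mathcal P_R)$, i.e. $\mathcal K^b(\mathcal P_R)$ is the smallest triangulated subcategory closed under direct summands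 that contains $T$. For a finite interval $[a,b]$ with $T\in\mathcal D^{[a,b]}$, let $\mathcal X_T^{[a,b]}$ be the class of all $X$ for which there are triangles $X_i\to T_i\to X_{i+1}\to X_i[1]$ for all $i\ge 0$, with $X_0=X$, all $T_i\in\mathrm{add}_{\mathcal D}T$ and all $X_i\in{}^{\perp_{k>0}}T\cap\mathcal D^{[a,b]}$; let $\mathcal X_T^{\flat}$ be the union of these classes over all such intervals. $T$ is Wakamatsu-silting if it is semi-selforthogonal and the regular module $R$ (in degree $0$) is isomorphic to $X[n]$ for some $X\in\mathcal X_T^{\flat}$ and some $n\ge 0$. $R$ satisfies the finitistic dimension conjecture if there is an integer $n\geq 0$ such that every $M\in\mathrm{mod}\,R$ of finite projective dimension has projective dimension at most $n$. $R$ is an Igusa–Todorov algebra if for some $n\ge 0$ there is $V\in\mathrm{mod}\,R$ such that for every $M\in\mathrm{mod}\,R$ there is an exact sequence $0\to V_1\to V_0\to \Omega^nM\oplus P\to 0$ with $V_0,V_1\in\mathrm{add}\,V$ and $P$ finitely generated projective, where $\Omega^n M$ is an $n$-th syzygy of $M$. Theorem. (i) If the injective dimension of ${}_RR$ is finite, then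 $R$ satisfies the finitistic dimension conjecture. (ii) If $R$ is an Igusa–Todorov algebra, then $R$ satisfies the finitistic dimension conjecture. (iii) If $R$ satisfies the finitistic dimension conjecture, then every compact Wakamatsu-silting complex over $R$ is silting. -/

import Mathlib

open CategoryTheory CategoryTheory.Limits CategoryTheory.Pretriangulated

universe w v u

/-- A ring `R` is an artin algebra if it is an algebra, finitely generated as a module, over some
commutative artinian ring `k`. (There is no loss in taking `k` in the universe of `R`, since `k`
may be replaced by its image in `R`.) -/
class IsArtinAlgebra (R : Type u) [Ring R] : Prop where
  exists_base : ∃ (k : Type u) (_ : CommRing k) (_ : IsArtinianRing k) (_ : Algebra k R),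
    Module.Finite k R

/-- An artin algebra is left noetherian; this makes `FGModuleCat R` (the category `mod R` of
finitely generated left `R`-modules) abelian. -/
instance IsArtinAlgebra.isNoetherianRing (R : Type u) [Ring R] [h : IsArtinAlgebra R] :
    IsNoetherianRing R := by
  obtain ⟨k, _, _, _, _⟩ := h.exists_base
  exact isNoetherian_of_tower k (isNoetherian_of_isNoetherianRing_of_finite k R)

namespace WakamatsuSilting

noncomputable section

/-- `add M`: the direct summands (retracts) of finite direct sums of copies of `M`. -/
def addClosure {C : Type u} [Category.{v} C] [Preadditive C] [HasFiniteBiproducts C] (M : C) :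
    ObjectProperty C :=
  fun X => ∃ n : ℕ, Nonempty (Retract X (⨁ fun _ : Fin n => M))

section Modules

variable (R : Type u) [Ring R]

/-- The finitistic dimension conjecture holds for `R`: the projective dimensions of the finitely
generated left `R`-modules of finite projective dimension are bounded. -/
def FinitisticDimensionConjecture : Prop :=
  ∃ n : ℕ, ∀ M : FGModuleCat.{u} R,
    projectiveDimension M.obj ≠ ⊤ → projectiveDimension M.obj ≤ n

variable [IsNoetherianRing R]

instance : HasFiniteBiproducts (FGModuleCat.{u} R) :=
  Abelian.hasFiniteBiproducts

/-- `IsSyzygy R n M K`: there is an exact sequence `0 → K → Pₙ₋₁ → ⋯ → P₀ → M → 0` with all `Pᵢ`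
finitely generated projective (the resolution need not be minimal). -/
def IsSyzygy : ℕ → FGModuleCat.{u} R → FGModuleCat.{u} R → Prop
  | 0, M, K => Nonempty (K ≅ M)
  | n + 1, M, K => ∃ S : ShortComplex (FGModuleCat.{u} R), S.ShortExact ∧
      Module.Projective R S.X₂ ∧ Nonempty (S.X₃ ≅ M) ∧ IsSyzygy n S.X₁ K

/-- `R` is an Igusa–Todorov algebra: for some `n` there is a finitely generated module `V` such
that every finitely generated module `M` admits an exact sequence
`0 → V₁ → V₀ → Ωⁿ M ⊕ P → 0` with `V₁, V₀ ∈ add V` and `P` finitely generated projective. -/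
def IsIgusaTodorov : Prop :=
  ∃ (n : ℕ) (V : FGModuleCat.{u} R), ∀ M : FGModuleCat.{u} R,
    ∃ (K P : FGModuleCat.{u} R) (S : ShortComplex (FGModuleCat.{u} R)),
      IsSyzygy R n M K ∧ Module.Projective R P ∧ S.ShortExact ∧
      addClosure V S.X₁ ∧ addClosure V S.X₂ ∧ Nonempty (S.X₃ ≅ K ⊞ P)

end Modules

section Derived

variable {R : Type u} [Ring R] [IsNoetherianRing R] [HasDerivedCategory.{w} (FGModuleCat.{u} R)]

/-- `D^[a,b](mod R)`: the complexes whose cohomology is concentrated in degrees in `[a,b]`. -/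
def inInterval (a b : ℤ) : ObjectProperty (DerivedCategory (FGModuleCat.{u} R)) :=
  fun X => X.IsGE a ∧ X.IsLE b

variable (R) in
/-- The objects of `K^b(P_R)`, as objects of the derived category: those isomorphic to a bounded
complex of finitely generated projective modules. -/
def perfect : ObjectProperty (DerivedCategory (FGModuleCat.{u} R)) :=
  fun X => ∃ P : CochainComplex (FGModuleCat.{u} R) ℤ,
    (∃ a b : ℤ, P.IsStrictlyGE a ∧ P.IsStrictlyLE b) ∧
    (∀ i : ℤ, Module.Projective R (P.X i)) ∧
    Nonempty (X ≅ DerivedCategory.Q.obj P)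

/-- `^{⊥_{k>0}} M`: the objects `X` with `Hom(X, M[k]) = 0` for all `k > 0`. -/
def leftPerp (M : DerivedCategory (FGModuleCat.{u} R)) :
    ObjectProperty (DerivedCategory (FGModuleCat.{u} R)) :=
  fun X => ∀ k : ℤ, 0 < k → ∀ f : X ⟶ M⟦k⟧, f = 0

/-- `M` is semi-selforthogonal: `Hom(M, M[k]) = 0` for all `k > 0`. -/
def IsSemiSelfOrthogonal (M : DerivedCategory (FGModuleCat.{u} R)) : Prop :=
  leftPerp M M

/-- `𝒳_M^[a,b]`: the objects `X` for which there are triangles `Xᵢ → Mᵢ → Xᵢ₊₁ →` for all `i ≥ 0`,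
with `X₀ = X`, all `Mᵢ ∈ add M` and all `Xᵢ ∈ ^{⊥_{k>0}} M ∩ D^[a,b](mod R)`. -/
def coAuslanderInterval (M : DerivedCategory (FGModuleCat.{u} R)) (a b : ℤ) :
    ObjectProperty (DerivedCategory (FGModuleCat.{u} R)) :=
  fun X => ∃ Y N : ℕ → DerivedCategory (FGModuleCat.{u} R),
    Nonempty (Y 0 ≅ X) ∧
    ∀ i : ℕ, leftPerp M (Y i) ∧ inInterval a b (Y i) ∧ addClosure M (N i) ∧
      ∃ (f : Y i ⟶ N i) (g : N i ⟶ Y (i + 1)) (h : Y (i + 1) ⟶ (Y i)⟦(1 : ℤ)⟧),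
        Triangle.mk f g h ∈ distTriang (DerivedCategory (FGModuleCat.{u} R))

/-- The co-Auslander class `𝒳_M^♭`: the union of the `𝒳_M^[a,b]` over the finite intervals
`[a,b]` with `M ∈ D^[a,b](mod R)`. -/
def coAuslander (M : DerivedCategory (FGModuleCat.{u} R)) :
    ObjectProperty (DerivedCategory (FGModuleCat.{u} R)) :=
  fun X => ∃ a b : ℤ, inInterval a b M ∧ coAuslanderInterval M a b X

/-- `⟨𝒞⟩₊`: the objects `C[n]` with `C ∈ 𝒞` and `n ≥ 0`. -/
def shiftPlus (𝒞 : ObjectProperty (DerivedCategory (FGModuleCat.{u} R))) :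
    ObjectProperty (DerivedCategory (FGModuleCat.{u} R)) :=
  fun X => ∃ (Y : DerivedCategory (FGModuleCat.{u} R)) (n : ℕ),
    𝒞 Y ∧ Nonempty (X ≅ Y⟦(n : ℤ)⟧)

variable (R) in
/-- The regular module `_R R`, as a complex concentrated in degree `0`. -/
def regular : DerivedCategory (FGModuleCat.{u} R) :=
  (DerivedCategory.singleFunctor (FGModuleCat.{u} R) 0).obj (FGModuleCat.of R R)

/-- `T` is a Wakamatsu-silting complex: `T ∈ D^b(mod R)` is semi-selforthogonal and
`R ∈ ⟨𝒳_T^♭⟩₊`. -/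
structure IsWakamatsuSilting (T : DerivedCategory (FGModuleCat.{u} R)) : Prop where
  bounded : DerivedCategory.TStructure.t.bounded T
  semiSelfOrthogonal : IsSemiSelfOrthogonal T
  regular_mem : shiftPlus (coAuslander T) (regular R)

/-- `T` is a silting complex: `T ∈ K^b(P_R)` is semi-selforthogonal and generates `K^b(P_R)`, that
is, `K^b(P_R)` is the smallest triangulated subcategory closed under direct summands that
contains `T`. -/
structure IsSilting (T : DerivedCategory (FGModuleCat.{u} R)) : Prop where
  perfect_mem : perfect R T
  semiSelfOrthogonal : IsSemiSelfOrthogonal T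
  generates : (ObjectProperty.singleton T).triangEnvelope = perfect R

end Derived

end

end WakamatsuSilting

/-!
(i) Every module is a quotient of one in `add R`, whose injective dimension is at most
`d = inj.dim R`; dimension shifting along such quotients shows that, for `X` of finite projective
dimension, the vanishing of `Ext^i(X, -)` for `i > d + m + 1` descends to `i > d + m`, down to
`m = 0`.

(ii) The syzygy is an endomorphism `Ω` of the monoid of stable isomorphism classes. By Krull–Schmidt
the classes of `add V` lie in a finitely generated submonoid. By Rédei's theorem (congruences of a
finitely generated commutative monoid satisfy the ascending chain condition) there is an `n` such
that `Ω^r x = Ω^r y` for some `r` implies `Ω^n x = Ω^n y` on that submonoid. Let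
`0 ⟶ V₁ ⟶ V₀ ⟶ X ⟶ 0` be exact with `V₀, V₁ ∈ add V` and `pd X < ∞`. Then `V₁ ⟶ V₀` induces
isomorphisms on `Ext^i` for `i ≫ 0`, so `Ω^r V₁` and `Ω^r V₀` are stably isomorphic for large `r`,
hence for `r = n`. The map `Ω^n V₁ ⟶ Ω^n V₀` thereby becomes an endomorphism of `Ω^n V₁`, which by
Fitting's lemma is the sum of an automorphism and a nilpotent endomorphism of a summand `Z`. Being
nilpotent and bijective on high `Ext` groups, the latter forces `pd Z < ∞`, and `pd Z` is bounded
because only finitely many indecomposables occur. So the degree from which `V₁ ⟶ V₀` induces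
isomorphisms is bounded, and with it `pd X`.

(iii) Let `Yᵢ ⟶ Nᵢ ⟶ Yᵢ₊₁ ⟶ Yᵢ[1]` be a coresolution of a shift `Y₀` of `R` by `Nᵢ ∈ add T`, inside
`D^[a,b]`. The `Yᵢ` are perfect, so finitistic dimension `d` makes them left orthogonal to
`D^{< a - d}`. Since `Hom(Yₘ₊₁, Nᵢ[k]) = 0` for `k > 0`, the vanishing of `Hom(Yₘ₊₁, Y₀[m + 1])`
propagates to that of `Hom(Yₘ₊₁, Yₘ[1])`. For large `m` the connecting map therefore vanishes, so
`Yₘ₊₁` is a summand of `Nₘ`, and `R` lies in the thick subcategory generated by `T`.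
-/

namespace WakamatsuSilting

section AddClosure

variable {C : Type u} [Category.{v} C] [Preadditive C] [HasFiniteBiproducts C]

lemma isZero_map_of_addClosure {D : Type*} [Category* D] [Preadditive D] (F : C ⥤ D) [F.Additive]
    {M X : C} (hX : addClosure M X) (hM : IsZero (F.obj M)) : IsZero (F.obj X) := by
  obtain ⟨n, ⟨r⟩⟩ := hX
  have h : 𝟙 (F.obj (⨁ fun _ : Fin n ↦ M)) = 0 := by
    rw [← F.map_id, ← biproduct.total, F.map_sum]
    refine Finset.sum_eq_zero fun j _ ↦ ?_
    rw [F.map_comp, hM.eq_of_tgt (F.map (biproduct.π (fun _ : Fin n ↦ M) j)) 0, zero_comp]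
  exact IsZero.of_mono (r.map F).i ((IsZero.iff_id_eq_zero _).2 h)

lemma addClosure_map {D : Type*} [Category* D] [Preadditive D] [HasFiniteBiproducts D]
    (F : C ⥤ D) [F.Additive] {M X : C} : addClosure M X → addClosure (F.obj M) (F.obj X) :=
  fun ⟨n, ⟨r⟩⟩ ↦ ⟨n, ⟨(r.map F).trans (Retract.ofIso (F.mapBiproduct _))⟩⟩

lemma addClosure_le {P : ObjectProperty C} [P.IsClosedUnderFiniteProducts]
    [P.IsStableUnderRetracts] {M : C} (hM : P M) : addClosure M ≤ P := by
  rintro X ⟨n, ⟨r⟩⟩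
  exact P.prop_of_retract r (P.prop_of_isLimit_fan (biproduct.isLimit _) fun _ ↦ hM)

instance {J : Type*} [Finite J] (X : J → C) [∀ j, Projective (X j)] : Projective (⨁ X) where
  factors f e _ := ⟨biproduct.desc fun j ↦ Projective.factorThru (biproduct.ι X j ≫ f) e, by
    ext; simp⟩

end AddClosure

section ProjectiveDimension

open Abelian

variable {C : Type u} [Category.{v} C] [Abelian C]

/-- The projective dimensions of the objects of `C` of finite projective dimension are at
most `d`. -/
def HasFinitisticDimensionLE (C : Type u) [Category.{v} C] [Abelian C] (d : ℕ) : Prop :=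
  ∀ X : C, (∃ m, HasProjectiveDimensionLT X m) → HasProjectiveDimensionLT X (d + 1)

attribute [local instance] Abelian.hasFiniteBiproducts in
lemma hasInjectiveDimensionLT_of_addClosure {G X : C} (hX : addClosure G X) (n : ℕ)
    [HasInjectiveDimensionLT G n] : HasInjectiveDimensionLT X n := by
  let := HasExt.standard C
  rw [hasInjectiveDimensionLT_iff]
  intro i hi Y e
  have hG : IsZero ((extFunctorObj Y i).obj G) :=
    @AddCommGrpCat.isZero_of_subsingleton _ (subsingleton_of_forall_eq 0
      fun x ↦ Ext.eq_zero_of_hasInjectiveDimensionLT (X := G) x n hi)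
  exact (AddCommGrpCat.subsingleton_of_isZero
    (isZero_map_of_addClosure (extFunctorObj Y i) hX hG)).elim e 0

lemma HasFinitisticDimensionLE.of_hasInjectiveDimensionLT {d : ℕ}
    (h : ∀ X : C, ∃ (Y : C) (p : Y ⟶ X), Epi p ∧ HasInjectiveDimensionLT Y (d + 1)) :
    HasFinitisticDimensionLE C d := by
  let := HasExt.standard C
  suffices key : ∀ (X : C) (m : ℕ),
      HasProjectiveDimensionLT X (d + 1 + m) → HasProjectiveDimensionLT X (d + 1) by
    rintro X ⟨m, hm⟩
    exact key X m (hasProjectiveDimensionLT_of_ge X m _ (by lia))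
  intro X m
  induction m with
  | zero => exact id
  | succ m ih =>
    refine fun hX ↦ ih ((hasProjectiveDimensionLT_iff _ _).2 fun i hi Z e ↦ ?_)
    obtain ⟨Y, p, _, _⟩ := h Z
    have hS : (ShortComplex.mk _ _ (kernel.condition p)).ShortExact :=
      { exact := ShortComplex.exact_kernel _ }
    obtain ⟨x, rfl⟩ := Ext.covariant_sequence_exact₃ X hS e rfl
      (Ext.eq_zero_of_hasProjectiveDimensionLT _ (d + 1 + (m + 1)) (by lia))
    rw [Ext.eq_zero_of_hasInjectiveDimensionLT (X := Y) x (d + 1) (by lia), Ext.zero_comp]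

variable {D : Type*} [Category* D] [Abelian D] (F : C ⥤ D) [F.Additive] [PreservesFiniteLimits F]
  [PreservesFiniteColimits F] [EnoughProjectives C] [F.PreservesProjectiveObjects]

lemma hasProjectiveDimensionLT_map (X : C) (n : ℕ) (hX : HasProjectiveDimensionLT X n) :
    HasProjectiveDimensionLT (F.obj X) n := by
  match n with
  | 0 =>
    rw [hasProjectiveDimensionLT_zero_iff_isZero] at hX ⊢
    exact F.map_isZero hX
  | 1 =>
    rw [← projective_iff_hasProjectiveDimensionLT_one] at hX ⊢
    exact F.projective_obj X
  | n + 2 =>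
    have hS : (ShortComplex.mk _ _ (kernel.condition (Projective.π X))).ShortExact :=
      { exact := ShortComplex.exact_kernel _ }
    exact ((hS.map_of_exact F).hasProjectiveDimensionLT_X₃_iff n (F.projective_obj _)).2
      (hasProjectiveDimensionLT_map _ _
        ((hS.hasProjectiveDimensionLT_X₃_iff n (Projective.projective_over X)).1 hX))

variable [F.Full] [F.Faithful]

lemma hasProjectiveDimensionLT_of_map (X : C) (n : ℕ)
    (hX : HasProjectiveDimensionLT (F.obj X) n) :
    HasProjectiveDimensionLT X n := by
  let := HasExt.standard C
  let := HasExt.standard D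
  rw [hasProjectiveDimensionLT_iff]
  intro i hi Y e
  apply (F.mapExt_bijective_of_preservesProjectiveObjects X Y i).injective
  rw [map_zero]
  exact Ext.eq_zero_of_hasProjectiveDimensionLT (X := F.obj X) _ n hi

lemma hasInjectiveDimensionLT_of_map (X : C) (n : ℕ)
    (hX : HasInjectiveDimensionLT (F.obj X) n) :
    HasInjectiveDimensionLT X n := by
  let := HasExt.standard C
  let := HasExt.standard D
  rw [hasInjectiveDimensionLT_iff]
  intro i hi Y e
  apply (F.mapExt_bijective_of_preservesProjectiveObjects Y X i).injective
  rw [map_zero]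
  exact Ext.eq_zero_of_hasInjectiveDimensionLT (X := F.obj X) _ n hi

end ProjectiveDimension

section Modules

variable {R : Type u} [Ring R] [IsNoetherianRing R]

open FGModuleCat

instance : (forget₂ (FGModuleCat.{u} R) (ModuleCat.{u} R)).Additive where

lemma epi_iff_surjective {M N : FGModuleCat.{u} R} (f : M ⟶ N) :
    Epi f ↔ Function.Surjective f.hom.hom :=
  ((forget₂ _ (ModuleCat.{u} R)).epi_map_iff_epi f).symm.trans (ModuleCat.epi_iff_surjective _)

lemma projective_of_module_projective (M : FGModuleCat.{u} R) [Module.Projective R M] :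
    Projective M where
  factors f e he := by
    obtain ⟨g, hg⟩ := Module.projective_lifting_property e.hom.hom f.hom.hom
      ((epi_iff_surjective e).1 he)
    exact ⟨ConcreteCategory.ofHom g, by ext x; exact LinearMap.congr_fun hg x⟩

instance : Projective (of R R) := projective_of_module_projective _

lemma exists_epi_from_biproduct_regular (M : FGModuleCat.{u} R) :
    ∃ (n : ℕ) (p : (⨁ fun _ : Fin n ↦ of R R) ⟶ M), Epi p := by
  obtain ⟨n, s, hs⟩ := Module.Finite.exists_fin (R := R) (M := M)
  let p : (⨁ fun _ : Fin n ↦ of R R) ⟶ M :=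
    biproduct.desc fun i ↦ ofHom (LinearMap.toSpanSingleton R M (s i))
  refine ⟨n, p, Preadditive.epi_of_cancel_zero p fun {N} g hg ↦ ?_⟩
  ext : 1
  refine LinearMap.ext_on_range hs fun i ↦ ?_
  have hi : ofHom (LinearMap.toSpanSingleton R M (s i)) ≫ g = 0 := by
    simpa [p] using biproduct.ι (fun _ ↦ of R R) i ≫= hg
  rw [← LinearMap.toSpanSingleton_apply_one R M (s i)]
  exact ConcreteCategory.congr_hom hi (1 : R)

instance : EnoughProjectives (FGModuleCat.{u} R) where
  presentation M := by
    obtain ⟨n, p, _⟩ := exists_epi_from_biproduct_regular M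
    exact ⟨{ p := ⨁ fun _ ↦ of R R, f := p }⟩

lemma addClosure_regular_of_projective (M : FGModuleCat.{u} R) [Projective M] :
    addClosure (of R R) M := by
  obtain ⟨n, p, _⟩ := exists_epi_from_biproduct_regular M
  exact ⟨n, ⟨⟨Projective.factorThru (𝟙 M) p, p, Projective.factorThru_comp _ _⟩⟩⟩

instance : (forget₂ (FGModuleCat.{u} R) (ModuleCat.{u} R)).PreservesProjectiveObjects where
  projective_obj {M} _ := by
    obtain ⟨n, ⟨r⟩⟩ := addClosure_regular_of_projective M
    have (j : Fin n) :
        Projective (((forget₂ _ (ModuleCat.{u} R)).obj ∘ fun _ : Fin n ↦ of R R) j) :=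
      (IsProjective.iff_projective (R := R) R).1 inferInstance
    have := Projective.of_iso ((forget₂ _ (ModuleCat.{u} R)).mapBiproduct
      fun _ : Fin n ↦ of R R).symm (inferInstanceAs (Projective (⨁ fun _ ↦ _)))
    exact (r.map (forget₂ _ (ModuleCat.{u} R))).projective

lemma projective_iff (M : FGModuleCat.{u} R) : Projective M ↔ Module.Projective R M :=
  ⟨fun _ ↦ (IsProjective.iff_projective (R := R) M).2
    ((forget₂ _ (ModuleCat.{u} R)).projective_obj M), fun _ ↦ projective_of_module_projective M⟩

lemma hasProjectiveDimensionLT_obj_iff (M : FGModuleCat.{u} R) (n : ℕ) :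
    HasProjectiveDimensionLT M.obj n ↔ HasProjectiveDimensionLT M n :=
  ⟨hasProjectiveDimensionLT_of_map (forget₂ _ (ModuleCat.{u} R)) M n,
    hasProjectiveDimensionLT_map (forget₂ _ (ModuleCat.{u} R)) M n⟩

variable (R) in
lemma finitisticDimensionConjecture_iff :
    FinitisticDimensionConjecture R ↔ ∃ d, HasFinitisticDimensionLE (FGModuleCat.{u} R) d := by
  have finite_iff (M : FGModuleCat.{u} R) :
      projectiveDimension M.obj ≠ ⊤ ↔ ∃ m, HasProjectiveDimensionLT M m := by
    simp only [projectiveDimension_ne_top_iff, HasProjectiveDimensionLE,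
      hasProjectiveDimensionLT_obj_iff]
    exact ⟨fun ⟨m, hm⟩ ↦ ⟨_, hm⟩,
      fun ⟨m, hm⟩ ↦ ⟨m, hasProjectiveDimensionLT_of_ge M m _ (Nat.le_succ m)⟩⟩
  simp only [FinitisticDimensionConjecture, HasFinitisticDimensionLE, finite_iff,
    projectiveDimension_le_iff, HasProjectiveDimensionLE, hasProjectiveDimensionLT_obj_iff]

theorem finitisticDimensionConjecture_of_injectiveDimension_ne_top
    (h : injectiveDimension (ModuleCat.of R R) ≠ ⊤) : FinitisticDimensionConjecture R := by
  obtain ⟨d, hd⟩ := (injectiveDimension_ne_top_iff _).1 h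
  have : HasInjectiveDimensionLT (of R R) (d + 1) :=
    hasInjectiveDimensionLT_of_map (forget₂ _ (ModuleCat.{u} R)) _ _ hd
  refine (finitisticDimensionConjecture_iff R).2 ⟨d, .of_hasInjectiveDimensionLT fun M ↦ ?_⟩
  obtain ⟨n, p, hp⟩ := exists_epi_from_biproduct_regular M
  exact ⟨_, p, hp, hasInjectiveDimensionLT_of_addClosure ⟨n, ⟨Retract.refl _⟩⟩ (d + 1)⟩

end Modules

section LeftOrthogonal

variable {C : Type u} [Category.{v} C] [HasZeroMorphisms C] (P : ObjectProperty C)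

instance : P.leftOrthogonal.IsStableUnderRetracts where
  of_retract r hY Z f hZ := by
    rw [← Category.id_comp f, ← r.retract, Category.assoc, hY (r.r ≫ f) hZ, comp_zero]

end LeftOrthogonal

section Triangulated

open Triangulated

variable {D : Type u} [Category.{v} D] [Preadditive D] [HasZeroObject D] [HasShift D ℤ]
  [∀ n : ℤ, (shiftFunctor D n).Additive] [Pretriangulated D]

lemma isLE_of_retract (t : TStructure D) {X Y : D} (r : Retract X Y) (n : ℤ) [t.IsLE Y n] :
    t.IsLE X n := by
  refine (t.isLE_iff_orthogonal n (n + 1) rfl X).2 fun Z f _ ↦ ?_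
  rw [← Category.id_comp f, ← r.retract, Category.assoc,
    t.zero (r.r ≫ f) n (n + 1) (by lia), comp_zero]

lemma isGE_of_retract (t : TStructure D) {X Y : D} (r : Retract X Y) (n : ℤ) [t.IsGE Y n] :
    t.IsGE X n := by
  refine (t.isGE_iff_orthogonal (n - 1) n (by lia) X).2 fun Z f _ ↦ ?_
  rw [← Category.comp_id f, ← r.retract, ← Category.assoc,
    t.zero (f ≫ r.i) (n - 1) n (by lia), zero_comp]

lemma hom_shift_obj₃_eq_zero {T : Triangle D} (hT : T ∈ distTriang D) {Z : D} {k l : ℤ}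
    (hkl : k + 1 = l) (h₁ : ∀ f : Z ⟶ T.obj₁⟦l⟧, f = 0) (h₂ : ∀ f : Z ⟶ T.obj₂⟦k⟧, f = 0)
    (f : Z ⟶ T.obj₃⟦k⟧) : f = 0 := by
  let T' := (Triangle.shiftFunctor D k).obj T
  let e : T.obj₁⟦k⟧⟦(1 : ℤ)⟧ ≅ T.obj₁⟦l⟧ := (shiftFunctorAdd' D k 1 l hkl).symm.app T.obj₁
  let δ : T.obj₃⟦k⟧ ⟶ T.obj₁⟦k⟧⟦(1 : ℤ)⟧ := T'.mor₃
  have hf : f ≫ δ = 0 := by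
    rw [← cancel_mono e.hom, zero_comp]
    exact h₁ _
  obtain ⟨g, rfl⟩ := Triangle.coyoneda_exact₃ T' (Triangle.shift_distinguished T hT k) f hf
  rw [h₂ g]
  exact zero_comp

/-- A sequence of distinguished triangles `Yᵢ → Nᵢ → Yᵢ₊₁ → Yᵢ[1]`: a coresolution of `Y₀` by
the `Nᵢ`, with cosyzygies `Yᵢ`. -/
def IsCoresolution (Y N : ℕ → D) : Prop :=
  ∀ i, ∃ (f : Y i ⟶ N i) (g : N i ⟶ Y (i + 1)) (h : Y (i + 1) ⟶ (Y i)⟦(1 : ℤ)⟧),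
    Triangle.mk f g h ∈ distTriang D

namespace IsCoresolution

variable {Y N : ℕ → D} (hY : IsCoresolution Y N)

include hY

lemma prop_iff_prop_zero (P : ObjectProperty D) [P.IsTriangulated] [P.IsClosedUnderIsomorphisms]
    (hN : ∀ i, P (N i)) (m : ℕ) : P (Y m) ↔ P (Y 0) := by
  induction m with
  | zero => rfl
  | succ m ih =>
    obtain ⟨f, g, h, hT⟩ := hY m
    exact ⟨fun hm ↦ ih.1 (P.ext_of_isTriangulatedClosed₁ _ hT (hN m) hm),
      fun h₀ ↦ P.ext_of_isTriangulatedClosed₃ _ hT (ih.2 h₀) (hN m)⟩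

lemma hom_shift_eq_zero {Z : D} (hZ : ∀ (i : ℕ) (k : ℤ), 0 < k → ∀ f : Z ⟶ (N i)⟦k⟧, f = 0)
    (m : ℕ) {k l : ℤ} (hk : 0 < k) (hkl : k + m = l) (h₀ : ∀ f : Z ⟶ (Y 0)⟦l⟧, f = 0)
    (f : Z ⟶ (Y m)⟦k⟧) : f = 0 := by
  induction m generalizing k with
  | zero =>
    obtain rfl : k = l := by simpa using hkl
    exact h₀ f
  | succ m ih =>
    obtain ⟨u, v, h, hT⟩ := hY m
    exact hom_shift_obj₃_eq_zero hT rfl (ih (by lia) (by push_cast at hkl; lia)) (hZ m k hk) f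

lemma nonempty_retract (m : ℕ)
    (hN : ∀ (i : ℕ) (k : ℤ), 0 < k → ∀ f : Y (m + 1) ⟶ (N i)⟦k⟧, f = 0)
    (h₀ : ∀ f : Y (m + 1) ⟶ (Y 0)⟦(1 + m : ℤ)⟧, f = 0) :
    Nonempty (Retract (Y (m + 1)) (N m)) := by
  obtain ⟨f, g, h, hT⟩ := hY m
  have hh : h = 0 := hY.hom_shift_eq_zero hN m one_pos rfl h₀ h
  obtain ⟨s, hs⟩ : ∃ s : Y (m + 1) ⟶ N m, 𝟙 _ = s ≫ g :=
    Triangle.coyoneda_exact₃ _ hT (𝟙 _) ((Category.id_comp _).trans hh)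
  exact ⟨⟨s, g, hs.symm⟩⟩

end IsCoresolution

end Triangulated

section Derived

open DerivedCategory DerivedCategory.TStructure

variable {C : Type u} [Category.{v} C] [Abelian C]

lemma projective_singleFunctor_X (P : C) [Projective P] (n i : ℤ) :
    Projective (((CochainComplex.singleFunctor C n).obj P).X i) := by
  by_cases hi : i = n
  · subst hi
    exact Projective.of_iso
      (HomologicalComplex.singleObjXSelf (ComplexShape.up ℤ) i P).symm inferInstance
  · exact (HomologicalComplex.isZero_single_obj_X (ComplexShape.up ℤ) n P i hi).projective

variable [HasDerivedCategory.{w} C]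

lemma Q_map_surjective (K L : CochainComplex C ℤ) [K.IsKProjective] :
    Function.Surjective (Q.map : (K ⟶ L) → (Q.obj K ⟶ Q.obj L)) := fun f ↦ by
  obtain ⟨g, hg⟩ := (CochainComplex.IsKProjective.Qh_map_bijective K _).surjective
    ((quotientCompQhIso C).hom.app K ≫ f ≫ (quotientCompQhIso C).inv.app L)
  obtain ⟨g, rfl⟩ := (HomotopyCategory.quotient _ _).map_surjective g
  refine ⟨g, ?_⟩
  rw [← cancel_epi ((quotientCompQhIso C).hom.app K), ← quotientCompQhIso_hom_naturality, hg]
  simp only [Category.assoc, Iso.inv_hom_id_app, Category.comp_id, Functor.comp_obj]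

lemma isLE_obj₃ {T : Triangle (DerivedCategory C)} (hT : T ∈ distTriang _) {n : ℤ}
    (hT₁ : T.obj₁.IsLE n) (hT₂ : T.obj₂.IsLE n) (hn : Epi ((homologyFunctor C n).map T.mor₁)) :
    T.obj₃.IsLE (n - 1) := by
  rw [isLE_iff]
  intro i hi
  have h₁ : IsZero ((homologyFunctor C (i + 1)).obj T.obj₁) := T.obj₁.isZero_of_isLE n _ (by lia)
  have : Epi ((homologyFunctor C i).map T.mor₂) :=
    (HomologySequence.epi_homologyMap_mor₂_iff T hT i (i + 1)).2 (h₁.eq_of_tgt _ _)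
  suffices h : (homologyFunctor C i).map T.mor₂ = 0 from IsZero.of_epi_eq_zero _ h
  obtain rfl | hi : i = n ∨ n < i := by lia
  · exact (HomologySequence.epi_homologyMap_mor₁_iff T hT i).1 hn
  · exact (T.obj₂.isZero_of_isLE n i hi).eq_of_src _ _

lemma epi_homologyFunctor_map_Q_map {K L : CochainComplex C ℤ} (φ : K ⟶ L) (n : ℤ)
    (hK : K.d n (n + 1) = 0) (hL : L.d n (n + 1) = 0) [Epi (φ.f n)] :
    Epi ((homologyFunctor C n).map (Q.map φ)) := by
  have := K.isIso_iCycles n (n + 1) (by simp) hK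
  have := L.isIso_iCycles n (n + 1) (by simp) hL
  have : Epi (HomologicalComplex.cyclesMap φ n) := by
    rw [← epi_comp_iff_of_isIso _ (L.iCycles n), HomologicalComplex.cyclesMap_i]
    exact epi_comp _ _
  have : Epi (HomologicalComplex.homologyMap φ n) :=
    epi_of_epi_fac (HomologicalComplex.homologyπ_naturality φ n)
  rw [← epi_comp_iff_of_isIso _ ((homologyFunctorFactors C n).hom.app L)]
  exact (homologyFunctorFactors C n).hom.naturality φ ▸ epi_comp' inferInstance this

/-- The left orthogonal of `D^{<n}`. For bounded complexes over a category with enough projectives,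
membership means being isomorphic to a bounded complex of projectives in degrees `≥ n`. -/
def projGE (n : ℤ) : ObjectProperty (DerivedCategory C) :=
  (t.le (n - 1)).leftOrthogonal

instance (n : ℤ) : (projGE n : ObjectProperty (DerivedCategory C)).IsTriangulatedClosed₂ :=
  inferInstanceAs (t.le (n - 1)).leftOrthogonal.IsTriangulatedClosed₂

instance (n : ℤ) : (projGE n : ObjectProperty (DerivedCategory C)).IsStableUnderRetracts :=
  inferInstanceAs (t.le (n - 1)).leftOrthogonal.IsStableUnderRetracts

lemma projGE.eq_zero {X Y : DerivedCategory C} {m n : ℤ} (hX : projGE n X) (hmn : m < n)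
    [hY : Y.IsLE m] (f : X ⟶ Y) : f = 0 :=
  hX f (t.le_monotone (by lia) _ hY.le)

lemma projGE_antitone : Antitone (projGE : ℤ → ObjectProperty (DerivedCategory C)) :=
  fun m n hmn _ hX _ f hY ↦ hX f (t.le_monotone (by lia) _ hY)

lemma projGE_shift {X : DerivedCategory C} {n : ℤ} (hX : projGE n X) (a : ℤ) {m : ℤ}
    (h : a + m = n) : projGE m (X⟦a⟧) := fun Y f hY ↦ by
  have : Y.IsLE (m - 1) := ⟨hY⟩
  have := t.isLE_shift Y (m - 1) (-a) (n - 1)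
  apply (shiftFunctor (DerivedCategory C) (-a)).map_injective
  let e : X ≅ X⟦a⟧⟦-a⟧ := (shiftEquiv _ a).unitIso.app X
  rw [Functor.map_zero, ← cancel_epi e.hom, comp_zero]
  exact hX.eq_zero (m := n - 1) (by lia) _

lemma projGE_obj₃ {T : Triangle (DerivedCategory C)} (hT : T ∈ distTriang _) {n : ℤ}
    (h₁ : projGE (n + 1) T.obj₁) (h₂ : projGE n T.obj₂) : projGE n T.obj₃ :=
  (projGE n).ext_of_isTriangulatedClosed₂ _ (rot_of_distTriang _ hT) h₂
    (projGE_shift h₁ 1 (add_comm 1 n))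

lemma projGE_Q_obj (K : CochainComplex C ℤ) (n : ℤ) [K.IsKProjective] [K.IsStrictlyGE n] :
    projGE n (Q.obj K) := fun Y f hY ↦ by
  have : Y.IsLE (n - 1) := ⟨hY⟩
  obtain ⟨L, _, ⟨e⟩⟩ := exists_iso_Q_obj_of_isLE Y (n - 1)
  obtain ⟨g, hg⟩ := Q_map_surjective K L (f ≫ e.hom)
  have hg₀ : g = 0 := by
    ext i
    by_cases hi : i < n
    · exact (K.isZero_of_isStrictlyGE n i hi).eq_of_src _ _
    · exact (L.isZero_of_isStrictlyLE (n - 1) i (by lia)).eq_of_tgt _ _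
  rw [← cancel_mono e.hom, ← hg, hg₀, Functor.map_zero, zero_comp]

lemma projGE_singleFunctor (P : C) [Projective P] (n : ℤ) :
    projGE n ((singleFunctor C n).obj P) := by
  have := projective_singleFunctor_X P n
  have := CochainComplex.isKProjective_of_projective ((CochainComplex.singleFunctor C n).obj P) n
  exact projGE_Q_obj ((CochainComplex.singleFunctor C n).obj P) n

lemma hasProjectiveDimensionLT_of_projGE {M : C} {d : ℕ}
    (hM : projGE (-d) ((singleFunctor C 0).obj M)) : HasProjectiveDimensionLT M (d + 1) := by
  let := HasExt.standard C
  rw [hasProjectiveDimensionLT_iff]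
  intro i hi N e
  have := t.isLE_shift ((singleFunctor C 0).obj N) 0 i (-i)
  ext
  rw [Abelian.Ext.zero_hom]
  exact hM.eq_zero (m := -i) (by lia) _

variable [EnoughProjectives C]

lemma projGE_of_hasProjectiveDimensionLT {M : C} {d : ℕ} (hM : HasProjectiveDimensionLT M (d + 1)) :
    projGE (-d) ((singleFunctor C 0).obj M) := by
  induction d generalizing M with
  | zero =>
    have := projective_iff_hasProjectiveDimensionLT_one.2 hM
    exact projGE_singleFunctor M 0
  | succ d ih =>
    have hS : (ShortComplex.mk _ _ (kernel.condition (Projective.π M))).ShortExact :=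
      { exact := ShortComplex.exact_kernel _ }
    have hK := (hS.hasProjectiveDimensionLT_X₃_iff d (Projective.projective_over M)).1 hM
    exact projGE_obj₃ hS.singleTriangle_distinguished (projGE_antitone (by lia) _ (ih hK))
      (projGE_antitone (by lia) _ (projGE_singleFunctor (Projective.over M) 0))

lemma exists_epi_homologyFunctor_map (X : DerivedCategory C) (n : ℤ) [X.IsLE n] :
    ∃ (P : C) (_ : Projective P) (f : (singleFunctor C n).obj P ⟶ X),
      Epi ((homologyFunctor C n).map f) := by
  obtain ⟨K, _, ⟨e⟩⟩ := exists_iso_Q_obj_of_isLE X n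
  have hd (j : ℤ) (hj : (ComplexShape.up ℤ).Rel n j) : K.d n j = 0 :=
    (K.isZero_of_isStrictlyLE n j (by simp at hj; lia)).eq_of_tgt _ _
  let φ : (HomologicalComplex.single C (ComplexShape.up ℤ) n).obj (Projective.over (K.X n)) ⟶ K :=
    HomologicalComplex.mkHomFromSingle (Projective.π (K.X n)) fun j hj ↦ by rw [hd j hj, comp_zero]
  have : Epi (φ.f n) := by
    rw [HomologicalComplex.mkHomFromSingle_f]
    exact epi_comp _ _
  have hφ := epi_homologyFunctor_map_Q_map φ n (by simp) (hd _ rfl)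
  refine ⟨Projective.over (K.X n), inferInstance, Q.map φ ≫ e.inv, ?_⟩
  exact (homologyFunctor C n).map_comp (Q.map φ) e.inv ▸ epi_comp' hφ inferInstance

lemma exists_triangle_of_isLE (X : DerivedCategory C) (b : ℤ) [X.IsLE b] :
    ∃ (P : C) (_ : Projective P) (X' : DerivedCategory C) (f : (singleFunctor C b).obj P ⟶ X)
      (g : X ⟶ X') (h : X' ⟶ ((singleFunctor C b).obj P)⟦(1 : ℤ)⟧),
      Triangle.mk f g h ∈ distTriang _ ∧ X'.IsLE (b - 1) := by
  obtain ⟨P, hP, f, hf⟩ := exists_epi_homologyFunctor_map X b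
  obtain ⟨X', g, h, hT⟩ := distinguished_cocone_triangle f
  exact ⟨P, hP, X', f, g, h, hT,
    isLE_obj₃ hT (inferInstanceAs (((singleFunctor C b).obj P).IsLE b)) ‹_› hf⟩

lemma exists_iso_singleFunctor_of_projGE {X : DerivedCategory C} {n : ℤ} [X.IsLE n]
    (hX : projGE n X) : ∃ P : C, Projective P ∧ Nonempty (X ≅ (singleFunctor C n).obj P) := by
  obtain ⟨P, hP, X', f, g, h, hT, hX'⟩ := exists_triangle_of_isLE X n
  obtain ⟨s, hs⟩ : ∃ s : X ⟶ (singleFunctor C n).obj P, 𝟙 X = s ≫ f :=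
    Triangle.coyoneda_exact₂ _ hT (𝟙 X) (hX.eq_zero (hY := hX') (by lia) _)
  let r : Retract X ((singleFunctor C n).obj P) := ⟨s, f, hs.symm⟩
  have := isGE_of_retract t r n
  obtain ⟨M, ⟨e⟩⟩ := exists_iso_singleFunctor_obj_of_isGE_of_isLE X n
  let r' := (Retract.ofIso e.symm).trans r
  let r₀ : Retract M P := ⟨(singleFunctor C n).preimage r'.i, (singleFunctor C n).preimage r'.r,
    (singleFunctor C n).map_injective (by simp)⟩
  exact ⟨M, r₀.projective, ⟨e⟩⟩

lemma prop_of_projGE (S : ObjectProperty (DerivedCategory C)) [S.IsTriangulatedClosed₂]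
    [S.IsClosedUnderIsomorphisms]
    (hS : ∀ (P : C) (i : ℤ), Projective P → S ((singleFunctor C i).obj P))
    {X : DerivedCategory C} {b n : ℤ} (hb : X.IsLE b) (hX : projGE n X) : S X := by
  have hmX : projGE (min n b) X := projGE_antitone (min_le_left n b) _ hX
  have hmb := min_le_right n b
  generalize min n b = m at hmX hmb
  clear hX
  induction b, hmb using Int.leInduction generalizing X with
  | base =>
    obtain ⟨P, hP, ⟨e⟩⟩ := exists_iso_singleFunctor_of_projGE hmX
    exact S.prop_of_iso e.symm (hS P m hP)
  | succ b hmb ih =>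
    obtain ⟨P, hP, X', f, g, h, hT, hX'⟩ := exists_triangle_of_isLE X (b + 1)
    exact S.ext_of_isTriangulatedClosed₂ _ hT (hS P _ hP) (ih (by simpa using hX')
      (projGE_obj₃ hT (projGE_antitone (by lia) _ (projGE_singleFunctor P (b + 1))) hmX))

lemma projGE_of_hasFinitisticDimensionLE {d : ℕ} (hd : HasFinitisticDimensionLE C d)
    {X : DerivedCategory C} {a b n : ℤ} (hab : a ≤ b) (ha : X.IsGE a) (hb : X.IsLE b)
    (hX : projGE n X) : projGE (a - d) X := by
  induction b, hab using Int.leInduction generalizing X n with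
  | base =>
    have := t.isGE_shift X a a 0
    have := t.isLE_shift X a a 0
    obtain ⟨M, ⟨e⟩⟩ := exists_iso_singleFunctor_obj_of_isGE_of_isLE (X⟦a⟧) 0
    have hM : projGE (-(a - n).toNat) ((singleFunctor C 0).obj M) :=
      (projGE _).prop_of_iso e (projGE_antitone (by lia) _ (projGE_shift hX a (add_sub_cancel a n)))
    have hM' := projGE_of_hasProjectiveDimensionLT (hd M ⟨_, hasProjectiveDimensionLT_of_projGE hM⟩)
    exact (projGE _).prop_of_iso ((shiftEquiv _ a).unitIso.symm.app X)
      (projGE_shift ((projGE _).prop_of_iso e.symm hM') (-a) (by lia))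
  | succ b hab ih =>
    obtain ⟨P, hP, X', f, g, h, hT, hX'⟩ := exists_triangle_of_isLE X (b + 1)
    have hP' := projGE_singleFunctor P (b + 1)
    have := t.isGE_shift ((singleFunctor C (b + 1)).obj P) (b + 1) 1 b
    have : X'.IsGE a := t.isGE₂ _ (rot_of_distTriang _ hT) _ ha
      (t.isGE_of_ge (((singleFunctor C (b + 1)).obj P)⟦(1 : ℤ)⟧) a b hab)
    exact (projGE _).ext_of_isTriangulatedClosed₂ _ hT (projGE_antitone (by lia) _ hP')
      (ih this (by simpa using hX') (projGE_obj₃ hT (n := min n b)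
        (projGE_antitone (by lia) _ hP') (projGE_antitone (by lia) _ hX)))

end Derived

section Perfect

open ZeroObject DerivedCategory DerivedCategory.TStructure

variable {R : Type u} [Ring R] [IsNoetherianRing R]

lemma isKProjective_of_module_projective (K : CochainComplex (FGModuleCat.{u} R) ℤ) (b : ℤ)
    [K.IsStrictlyLE b] (hK : ∀ i, Module.Projective R (K.X i)) : K.IsKProjective :=
  have (i : ℤ) : Projective (K.X i) := (projective_iff _).2 (hK i)
  CochainComplex.isKProjective_of_projective K b

variable [HasDerivedCategory.{w} (FGModuleCat.{u} R)]

instance : (perfect R).IsClosedUnderIsomorphisms where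
  of_iso e := fun ⟨P, hP, hP', ⟨e'⟩⟩ ↦ ⟨P, hP, hP', ⟨e.symm ≪≫ e'⟩⟩

instance : (perfect R).IsStableUnderShift ℤ where
  isStableUnderShiftBy n :=
    { le_shift := fun X ⟨P, ⟨a, b, _, _⟩, hP, ⟨e⟩⟩ ↦
        ⟨P⟦n⟧, ⟨a - n, b - n, P.isStrictlyGE_shift a n (a - n) (by lia),
          P.isStrictlyLE_shift b n (b - n) (by lia)⟩, fun i ↦ hP (i + n),
          ⟨(shiftFunctor _ n).mapIso e ≪≫ (Q.commShiftIso n).symm.app P⟩⟩ }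

lemma perfect_Q_obj_mappingCone {K L : CochainComplex (FGModuleCat.{u} R) ℤ} (f : K ⟶ L)
    (a b a' b' : ℤ) [K.IsStrictlyGE a] [K.IsStrictlyLE b] [L.IsStrictlyGE a'] [L.IsStrictlyLE b']
    (hK : ∀ i, Module.Projective R (K.X i)) (hL : ∀ i, Module.Projective R (L.X i)) :
    perfect R (Q.obj (CochainComplex.mappingCone f)) := by
  let e (i : ℤ) : (CochainComplex.mappingCone f).X i ≅ K.X (i + 1) ⊞ L.X i :=
    HomologicalComplex.homotopyCofiber.XIsoBiprod f i (i + 1) rfl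
  refine ⟨_, ⟨min (a - 1) a', max b b', ?_, ?_⟩, fun i ↦ ?_, ⟨Iso.refl _⟩⟩
  · rw [CochainComplex.isStrictlyGE_iff]
    exact fun i _ ↦ IsZero.of_iso ((biprod_isZero_iff _ _).2
      ⟨K.isZero_of_isStrictlyGE a _, L.isZero_of_isStrictlyGE a' _⟩) (e i)
  · rw [CochainComplex.isStrictlyLE_iff]
    exact fun i _ ↦ IsZero.of_iso ((biprod_isZero_iff _ _).2
      ⟨K.isZero_of_isStrictlyLE b _, L.isZero_of_isStrictlyLE b' _⟩) (e i)
  · rw [← projective_iff]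
    have := (projective_iff _).2 (hK (i + 1))
    have := (projective_iff _).2 (hL i)
    exact Projective.of_iso (e i).symm inferInstance

instance : (perfect R).IsTriangulatedClosed₃ := by
  refine .mk' fun T hT ⟨K, ⟨a, b, _, _⟩, hK, ⟨e⟩⟩ ⟨L, ⟨a', b', _, _⟩, hL, ⟨e'⟩⟩ ↦ ?_
  have := isKProjective_of_module_projective K b hK
  obtain ⟨f, hf⟩ := Q_map_surjective K L (e.inv ≫ T.mor₁ ≫ e'.hom)
  refine (perfect R).prop_of_iso (Triangle.π₃.mapIso (isoTriangleOfIso₁₂ _ _ hT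
    (mappingCone_triangle_distinguished f) e e' ?_).symm)
    (perfect_Q_obj_mappingCone f a b a' b' hK hL)
  exact ((congrArg (e.hom ≫ ·) hf).trans (e.hom_inv_id_assoc _)).symm

lemma perfect_singleFunctor (P : FGModuleCat.{u} R) (n : ℤ) [Projective P] :
    perfect R ((singleFunctor _ n).obj P) :=
  ⟨(CochainComplex.singleFunctor _ n).obj P, ⟨n, n, inferInstance, inferInstance⟩,
    fun i ↦ (projective_iff _).1 (projective_singleFunctor_X P n i), ⟨Iso.refl _⟩⟩

instance : (perfect R).IsTriangulated where
  exists_zero := ⟨(singleFunctor _ 0).obj 0, (singleFunctor _ 0).map_isZero (isZero_zero _),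
    perfect_singleFunctor _ 0⟩
  toIsTriangulatedClosed₂ := .of_isTriangulatedClosed₃

lemma perfect_iff (X : DerivedCategory (FGModuleCat.{u} R)) :
    perfect R X ↔ ∃ b n : ℤ, X.IsLE b ∧ projGE n X := by
  refine ⟨fun ⟨P, ⟨a, b, _, _⟩, hP, ⟨e⟩⟩ ↦ ?_, fun ⟨b, n, hb, hn⟩ ↦
    prop_of_projGE _ (fun P i _ ↦ perfect_singleFunctor P i) hb hn⟩
  have := isKProjective_of_module_projective P b hP
  exact ⟨b, a, t.isLE_of_iso e.symm b, (projGE a).prop_of_iso e.symm (projGE_Q_obj P a)⟩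

instance : (perfect R).IsStableUnderRetracts where
  of_retract r hY := by
    rw [perfect_iff] at hY ⊢
    obtain ⟨b, n, _, hn⟩ := hY
    exact ⟨b, n, isLE_of_retract t r b, (projGE n).prop_of_retract r hn⟩

lemma perfect_regular : perfect R (regular R) :=
  perfect_singleFunctor (FGModuleCat.of R R) 0

lemma perfect_le {S : ObjectProperty (DerivedCategory (FGModuleCat.{u} R))}
    [S.IsTriangulated] [S.IsStableUnderRetracts] (hS : S (regular R)) : perfect R ≤ S := by
  intro X hX
  obtain ⟨b, n, hb, hn⟩ := (perfect_iff X).1 hX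
  refine prop_of_projGE S (fun P i _ ↦ ?_) hb hn
  refine addClosure_le ?_ _
    (addClosure_map (singleFunctor _ i) (addClosure_regular_of_projective P))
  exact (S.prop_shift_iff_of_isStableUnderShift _ i).1
    (S.prop_of_iso
      (((singleFunctors _).shiftIso i 0 i (add_zero i)).symm.app (FGModuleCat.of R R)) hS)

end Perfect

section SiltingComplexes

open ZeroObject DerivedCategory DerivedCategory.TStructure

variable {R : Type u} [Ring R] [IsNoetherianRing R] [HasDerivedCategory.{w} (FGModuleCat.{u} R)]

lemma leftPerp.eq_zero_of_addClosure {T Z N : DerivedCategory (FGModuleCat.{u} R)}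
    (hZ : leftPerp T Z) (hN : addClosure T N) {k : ℤ} (hk : 0 < k) (f : Z ⟶ N⟦k⟧) : f = 0 := by
  have hT : IsZero ((shiftFunctor _ k ⋙ preadditiveCoyoneda.obj (.op Z)).obj T) :=
    @AddCommGrpCat.isZero_of_subsingleton _ (subsingleton_of_forall_eq 0 (hZ k hk))
  exact (AddCommGrpCat.subsingleton_of_isZero (isZero_map_of_addClosure
    (shiftFunctor _ k ⋙ preadditiveCoyoneda.obj (.op Z)) hN hT)).elim f 0

lemma projGE_of_perfect {d : ℕ} (hd : HasFinitisticDimensionLE (FGModuleCat.{u} R) d)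
    {X : DerivedCategory (FGModuleCat.{u} R)} (hX : perfect R X) (a : ℤ) [X.IsGE a] :
    projGE (a - d) X := by
  obtain ⟨b, n, _, hn⟩ := (perfect_iff X).1 hX
  exact projGE_of_hasFinitisticDimensionLE hd (le_max_left a b) ‹_›
    (t.isLE_of_le X b _ (le_max_right a b)) hn

lemma coAuslanderInterval.prop_of_perfect {d : ℕ}
    (hd : HasFinitisticDimensionLE (FGModuleCat.{u} R) d)
    {T X : DerivedCategory (FGModuleCat.{u} R)}
    {a b : ℤ} (hX : coAuslanderInterval T a b X) (hT : perfect R T) (hX' : perfect R X)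
    (S : ObjectProperty (DerivedCategory (FGModuleCat.{u} R))) [S.IsTriangulated]
    [S.IsStableUnderRetracts] (hS : S T) : S X := by
  obtain ⟨Y, N, ⟨e⟩, hY⟩ := hX
  have hYN : IsCoresolution Y N := fun i ↦ (hY i).2.2.2
  have hN (i : ℕ) : addClosure T (N i) := (hY i).2.2.1
  let m := (b - a + d).toNat
  have hYm : projGE (a - d) (Y (m + 1)) := by
    have := (hY (m + 1)).2.1.1
    refine projGE_of_perfect hd ((hYN.prop_iff_prop_zero (perfect R) ?_ _).2 ?_) a
    · exact fun i ↦ addClosure_le hT _ (hN i)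
    · exact (perfect R).prop_of_iso e.symm hX'
  obtain ⟨r⟩ : Nonempty (Retract (Y (m + 1)) (N m)) := by
    have := (hY 0).2.1.2
    have := t.isLE_shift (Y 0) b (1 + m) (b - (1 + m))
    exact hYN.nonempty_retract m (fun i k hk ↦ (hY _).1.eq_zero_of_addClosure (hN i) hk)
      (hYm.eq_zero (m := b - (1 + m)) (by lia))
  exact S.prop_of_iso e ((hYN.prop_iff_prop_zero S (fun i ↦ addClosure_le hS _ (hN i)) (m + 1)).1
    (S.prop_of_retract r (addClosure_le hS _ (hN m))))

theorem isSilting_of_isWakamatsuSilting (hR : FinitisticDimensionConjecture R)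
    {T : DerivedCategory (FGModuleCat.{u} R)} (hT : perfect R T) (hW : IsWakamatsuSilting T) :
    IsSilting T := by
  obtain ⟨d, hd⟩ := (finitisticDimensionConjecture_iff R).1 hR
  obtain ⟨X, n, ⟨a, b, -, hX⟩, ⟨e⟩⟩ := hW.regular_mem
  have regular_iff (P : ObjectProperty (DerivedCategory (FGModuleCat.{u} R))) [P.IsTriangulated]
      [P.IsClosedUnderIsomorphisms] : P (regular R) ↔ P X :=
    (P.prop_iff_of_iso e).trans (P.prop_shift_iff_of_isStableUnderShift X (n : ℤ))
  refine ⟨hT, hW.semiSelfOrthogonal, le_antisymm ?_ (perfect_le ?_)⟩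
  · rw [ObjectProperty.triangEnvelope_le_iff]
    simpa using hT
  · exact (regular_iff _).2 (hX.prop_of_perfect hd hT ((regular_iff _).1 perfect_regular) _
      (ObjectProperty.le_triangEnvelope _ _ (by simp)))

end SiltingComplexes

section LocalEndomorphismRings

variable {C : Type u} [Category.{v} C]

lemma nonempty_retract_of_isUnit {W X : C} (i : W ⟶ X) (r : X ⟶ W)
    (h : IsUnit (End.of (i ≫ r))) : Nonempty (Retract W X) := by
  have : IsIso (i ≫ r) := (isUnit_iff_isIso _).1 h
  exact ⟨⟨i, r ≫ inv (i ≫ r), by rw [← Category.assoc, IsIso.hom_inv_id]⟩⟩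

variable [Preadditive C]

lemma nonempty_iso_of_retract {W U : C} [Nontrivial (End W)] [IsLocalRing (End U)]
    (r : Retract W U) : Nonempty (W ≅ U) := by
  let p : End U := End.of (r.r ≫ r.i)
  have hp : IsIdempotentElem p := by simp [p, IsIdempotentElem, End.mul_def]
  rcases IsLocalRing.isUnit_or_isUnit_of_isUnit_add (a := p) (b := 1 - p)
      (by rw [add_sub_cancel]; exact isUnit_one) with h | h
  · exact ⟨⟨r.i, r.r, r.retract, (IsIdempotentElem.iff_eq_one_of_isUnit h).1 hp⟩⟩
  · have hp₀ : r.r ≫ r.i = 0 :=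
      sub_eq_self.1 ((IsIdempotentElem.iff_eq_one_of_isUnit h).1 hp.one_sub)
    have : 𝟙 W = 0 := by
      calc 𝟙 W = r.i ≫ (r.r ≫ r.i) ≫ r.r := by simp
        _ = 0 := by simp [hp₀]
    exact (one_ne_zero (α := End W) this).elim

variable {W : C} [IsLocalRing (End W)]

lemma retract_or_retract_of_retract_biprod [HasBinaryBiproducts C] {A B : C}
    (r : Retract W (A ⊞ B)) : Nonempty (Retract W A) ∨ Nonempty (Retract W B) := by
  have h : 𝟙 W =
      (r.i ≫ biprod.fst) ≫ biprod.inl ≫ r.r + (r.i ≫ biprod.snd) ≫ biprod.inr ≫ r.r := by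
    calc 𝟙 W = r.i ≫ (biprod.fst ≫ biprod.inl + biprod.snd ≫ biprod.inr) ≫ r.r := by simp
      _ = _ := by simp only [Preadditive.comp_add, Preadditive.add_comp, Category.assoc]
  have hu : IsUnit (M := End W) (𝟙 W) := isUnit_one
  rw [h] at hu
  exact (IsLocalRing.isUnit_or_isUnit_of_isUnit_add (R := End W) hu).imp
    (nonempty_retract_of_isUnit _ _) (nonempty_retract_of_isUnit _ _)

lemma exists_retract_of_retract_biproduct {ι : Type*} [Finite ι] {A : ι → C} [HasBiproduct A]
    (r : Retract W (⨁ A)) : ∃ j, Nonempty (Retract W (A j)) := by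
  have := Fintype.ofFinite ι
  have total : ∑ j, biproduct.π A j ≫ biproduct.ι A j = 𝟙 (⨁ A) :=
    IsBilimit.total (biproduct.isBilimit A)
  have h : 𝟙 W = ∑ j, (r.i ≫ biproduct.π A j) ≫ biproduct.ι A j ≫ r.r := by
    calc 𝟙 W = r.i ≫ (∑ j, biproduct.π A j ≫ biproduct.ι A j) ≫ r.r := by
          rw [total, Category.id_comp, r.retract]
      _ = _ := by simp only [Preadditive.sum_comp, Preadditive.comp_sum, Category.assoc]
  have hu : IsUnit (M := End W) (𝟙 W) := isUnit_one
  rw [h] at hu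
  obtain ⟨j, -, hj⟩ := IsLocalRing.exists_of_isUnit_sum (R := End W) hu
  exact ⟨j, nonempty_retract_of_isUnit _ _ hj⟩

end LocalEndomorphismRings

section KrullSchmidt

variable (C : Type u) [Category.{v} C] [Preadditive C] [HasBinaryBiproducts C]

/-- A category in which Fitting's lemma holds and whose objects have finite length. The length is
only asked to be additive on biproducts and to detect zero objects, which suffices for the
Krull–Schmidt property. -/
class HasFittingDecompositions : Prop where
  exists_length : ∃ ℓ : C → ℕ, (∀ X, ℓ X = 0 → IsZero X) ∧
    ∀ {X Y Z : C}, (X ≅ Y ⊞ Z) → ℓ X = ℓ Y + ℓ Z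
  exists_fitting {X : C} (f : X ⟶ X) : ∃ (Y Z : C) (e : X ≅ Y ⊞ Z) (u : Y ⟶ Y) (z : Z ⟶ Z),
    IsIso u ∧ IsNilpotent (End.of z) ∧ f = e.hom ≫ biprod.map u z ≫ e.inv

variable {C}

lemma isIso_biprod_map {A B A' B' : C} (f : A ⟶ B) (g : A' ⟶ B') [IsIso f] [IsIso g] :
    IsIso (biprod.map f g) :=
  (biprod.mapIso (asIso f) (asIso g)).isIso_hom

variable [HasFittingDecompositions C]

lemma isLocalRing_end_or_exists_iso_biprod {X : C} (hX : ¬ IsZero X) :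
    IsLocalRing (End X) ∨ ∃ Y Z : C, ¬ IsZero Y ∧ ¬ IsZero Z ∧ Nonempty (X ≅ Y ⊞ Z) := by
  by_contra! ⟨hloc, hdec⟩
  have : Nontrivial (End X) := ⟨𝟙 X, 0, fun h ↦ hX ((IsZero.iff_id_eq_zero X).2 h)⟩
  refine hloc (.of_isUnit_or_isUnit_one_sub_self fun (f : X ⟶ X) ↦ ?_)
  obtain ⟨Y, Z, e, u, z, hu, hz, hf⟩ := HasFittingDecompositions.exists_fitting f
  rw [isUnit_iff_isIso, isUnit_iff_isIso]
  by_cases hZ : IsZero Z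
  · have : IsIso z := ⟨0, hZ.eq_of_src _ _, hZ.eq_of_src _ _⟩
    have := isIso_biprod_map u z
    exact .inl (hf ▸ inferInstance)
  · have hY : IsZero Y := not_not.1 fun hY ↦ (hdec Y Z hY hZ).false e
    have : IsIso (𝟙 Y - u) := ⟨0, hY.eq_of_src _ _, hY.eq_of_src _ _⟩
    have : IsIso (𝟙 Z - z) := (isUnit_iff_isIso _).1 hz.isUnit_one_sub
    have := isIso_biprod_map (𝟙 Y - u) (𝟙 Z - z)
    have h : 𝟙 X - f = e.hom ≫ biprod.map (𝟙 Y - u) (𝟙 Z - z) ≫ e.inv := by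
      have : biprod.map (𝟙 Y - u) (𝟙 Z - z) = 𝟙 (Y ⊞ Z) - biprod.map u z := by ext <;> simp
      simp [this, hf]
    have h' : IsIso (𝟙 X - f) := h ▸ inferInstance
    exact .inr h'

theorem krullSchmidt_induction (P : ObjectProperty C) [P.IsClosedUnderIsomorphisms]
    (zero : ∀ X, IsZero X → P X) (isLocalRing : ∀ X, IsLocalRing (End X) → P X)
    (biprod : ∀ X Y, P X → P Y → P (X ⊞ Y)) (X : C) : P X := by
  obtain ⟨ℓ, hℓ₀, hℓ⟩ := HasFittingDecompositions.exists_length (C := C)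
  induction hX : ℓ X using Nat.strong_induction_on generalizing X with
  | h n ih =>
    by_cases hX₀ : IsZero X
    · exact zero X hX₀
    rcases isLocalRing_end_or_exists_iso_biprod hX₀ with hloc | ⟨Y, Z, hY, hZ, ⟨e⟩⟩
    · exact isLocalRing X hloc
    · have := hℓ e
      have := mt (hℓ₀ Y) hY
      have := mt (hℓ₀ Z) hZ
      exact P.prop_of_iso e.symm
        (biprod Y Z (ih (ℓ Y) (by lia) Y rfl) (ih (ℓ Z) (by lia) Z rfl))

lemma exists_finite_of_retract (V : C) :
    ∃ F : Set C, F.Finite ∧ ∀ W, IsLocalRing (End W) → Nonempty (Retract W V) →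
      ∃ U ∈ F, Nonempty (W ≅ U) := by
  let P : ObjectProperty C := fun V ↦ ∃ F : Set C, F.Finite ∧ ∀ W, IsLocalRing (End W) →
    Nonempty (Retract W V) → ∃ U ∈ F, Nonempty (W ≅ U)
  have : P.IsClosedUnderIsomorphisms := ⟨fun e ⟨F, hF, h⟩ ↦ ⟨F, hF, fun W hW ⟨r⟩ ↦
    h W hW ⟨r.trans e.symm.retract⟩⟩⟩
  refine krullSchmidt_induction P (fun V hV ↦ ⟨∅, Set.finite_empty, fun W hW ⟨r⟩ ↦ ?_⟩)
    (fun V hV ↦ ⟨{V}, Set.finite_singleton V, fun W hW ⟨r⟩ ↦ ⟨V, rfl, nonempty_iso_of_retract r⟩⟩)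
    (fun X Y ⟨F, hF, h⟩ ⟨G, hG, h'⟩ ↦ ⟨F ∪ G, hF.union hG, fun W hW ⟨r⟩ ↦ ?_⟩) V
  · refine (one_ne_zero (α := End W) ?_).elim
    change 𝟙 W = 0
    rw [← r.retract, hV.eq_of_tgt r.i 0, zero_comp]
  · rcases retract_or_retract_of_retract_biprod r with hr | hr
    · obtain ⟨U, hU, e⟩ := h W hW hr
      exact ⟨U, .inl hU, e⟩
    · obtain ⟨U, hU, e⟩ := h' W hW hr
      exact ⟨U, .inr hU, e⟩

end KrullSchmidt

section ExtIso

open Abelian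

variable {C : Type u} [Category.{v} C] [Abelian C]

/-- Two objects are stably isomorphic if they become isomorphic after adding projectives. -/
def StablyIso (A B : C) : Prop :=
  ∃ P Q : C, Projective P ∧ Projective Q ∧ Nonempty (A ⊞ P ≅ B ⊞ Q)

lemma StablyIso.symm {A B : C} : StablyIso A B → StablyIso B A :=
  fun ⟨P, Q, hP, hQ, ⟨e⟩⟩ ↦ ⟨Q, P, hQ, hP, ⟨e.symm⟩⟩

variable [HasExt.{w} C]

/-- The morphism `g : A ⟶ B` induces bijections `Ext^i(B, N) → Ext^i(A, N)` for all `i > n`. -/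
def ExtIso (n : ℕ) {A B : C} (g : A ⟶ B) : Prop :=
  ∀ (i : ℕ), n < i → ∀ N : C,
    Function.Bijective fun x : Ext B N i ↦ (Ext.mk₀ g).comp x (zero_add i)

namespace ExtIso

lemma mono {n m : ℕ} (h : n ≤ m) {A B : C} {g : A ⟶ B} (hg : ExtIso n g) : ExtIso m g :=
  fun i hi N ↦ hg i (by lia) N

lemma comp {n : ℕ} {A B D : C} {f : A ⟶ B} {g : B ⟶ D} (hf : ExtIso n f) (hg : ExtIso n g) :
    ExtIso n (f ≫ g) := fun i hi N ↦ by
  convert (hf i hi N).comp (hg i hi N) using 2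
  simp

lemma of_comp_left {n : ℕ} {A B D : C} {f : A ⟶ B} {g : B ⟶ D} (hf : ExtIso n f)
    (hfg : ExtIso n (f ≫ g)) : ExtIso n g := fun i hi N ↦ by
  rw [← Function.Bijective.of_comp_iff' (hf i hi N)]
  convert hfg i hi N using 2
  simp

lemma of_comp_right {n : ℕ} {A B D : C} {f : A ⟶ B} {g : B ⟶ D} (hg : ExtIso n g)
    (hfg : ExtIso n (f ≫ g)) : ExtIso n f := fun i hi N ↦ by
  rw [← Function.Bijective.of_comp_iff _ (hg i hi N)]
  convert hfg i hi N using 2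
  simp

lemma of_isIso {A B : C} (g : A ⟶ B) [IsIso g] (n : ℕ) : ExtIso n g := fun i _ N ↦ by
  refine Function.bijective_iff_has_inverse.2
    ⟨fun x ↦ (Ext.mk₀ (inv g)).comp x (zero_add i), fun x ↦ ?_, fun x ↦ ?_⟩ <;> simp

lemma of_hasProjectiveDimensionLT {A B : C} (g : A ⟶ B) (n : ℕ) [HasProjectiveDimensionLT A (n + 1)]
    [HasProjectiveDimensionLT B (n + 1)] : ExtIso n g := fun i hi N ↦ by
  have h₁ := HasProjectiveDimensionLT.subsingleton A (n + 1) i hi N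
  have h₂ := HasProjectiveDimensionLT.subsingleton B (n + 1) i hi N
  exact ⟨fun x y _ ↦ Subsingleton.elim x y, fun y ↦ ⟨0, Subsingleton.elim _ y⟩⟩

lemma biprod_map {n : ℕ} {A B A' B' : C} {f : A ⟶ B} {g : A' ⟶ B'} (hf : ExtIso n f)
    (hg : ExtIso n g) : ExtIso n (biprod.map f g) := fun i hi N ↦ by
  refine ⟨fun x y hxy ↦ ?_, fun y ↦ ?_⟩
  · apply Ext.biprod_ext
    · apply (hf i hi N).injective
      simpa using congrArg (fun z ↦ (Ext.mk₀ (biprod.inl : A ⟶ A ⊞ A')).comp z (zero_add i)) hxy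
    · apply (hg i hi N).injective
      simpa using congrArg (fun z ↦ (Ext.mk₀ (biprod.inr : A' ⟶ A ⊞ A')).comp z (zero_add i)) hxy
  · obtain ⟨a, ha⟩ := (hf i hi N).surjective ((Ext.mk₀ biprod.inl).comp y (zero_add i))
    obtain ⟨b, hb⟩ := (hg i hi N).surjective ((Ext.mk₀ biprod.inr).comp y (zero_add i))
    refine ⟨(Ext.mk₀ biprod.fst).comp a (zero_add i) + (Ext.mk₀ biprod.snd).comp b (zero_add i), ?_⟩
    dsimp only at ha hb ⊢
    apply Ext.biprod_ext
    · rw [← ha]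
      simp [Ext.comp_add]
    · rw [← hb]
      simp [Ext.comp_add]

lemma biprod_snd {A B A' B' : C} {n : ℕ} {f : A ⟶ B} {g : A' ⟶ B'}
    (h : ExtIso n (biprod.map f g)) : ExtIso n g := fun i hi N ↦ by
  refine ⟨fun x y hxy ↦ ?_, fun y ↦ ?_⟩
  · have : (Ext.mk₀ (biprod.snd : B ⊞ B' ⟶ B')).comp x (zero_add i) =
        (Ext.mk₀ biprod.snd).comp y (zero_add i) := by
      apply (h i hi N).injective
      simpa using congrArg (fun z ↦ (Ext.mk₀ (biprod.snd : A ⊞ A' ⟶ A')).comp z (zero_add i)) hxy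
    simpa using congrArg (fun z ↦ (Ext.mk₀ (biprod.inr : B' ⟶ B ⊞ B')).comp z (zero_add i)) this
  · obtain ⟨w, hw⟩ := (h i hi N).surjective ((Ext.mk₀ biprod.snd).comp y (zero_add i))
    refine ⟨(Ext.mk₀ biprod.inr).comp w (zero_add i), ?_⟩
    simpa using congrArg (fun z ↦ (Ext.mk₀ (biprod.inr : A' ⟶ A ⊞ A')).comp z (zero_add i)) hw

lemma hasProjectiveDimensionLT_of_isNilpotent {n : ℕ} {Z : C} {z : Z ⟶ Z} (hz : ExtIso n z)
    (h : IsNilpotent (End.of z)) : HasProjectiveDimensionLT Z (n + 1) := by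
  have hpow (k : ℕ) : ExtIso n ((End.of z ^ k : End Z) : Z ⟶ Z) := by
    induction k with
    | zero => exact of_isIso (𝟙 Z) n
    | succ k ih =>
      rw [pow_succ]
      exact hz.comp ih
  obtain ⟨k, hk⟩ := h
  have h₀ : ExtIso n (0 : Z ⟶ Z) := by
    have := hpow k
    rwa [hk] at this
  rw [hasProjectiveDimensionLT_iff]
  intro i hi N x
  apply (h₀ i hi N).injective
  simp

end ExtIso

section ShortExact

variable {S : ShortComplex C}

lemma extIso_f_of_shortExact (hS : S.ShortExact) (n : ℕ) [HasProjectiveDimensionLT S.X₃ (n + 1)] :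
    ExtIso n S.f := fun i hi N ↦ by
  refine ⟨fun x y hxy ↦ ?_, fun y ↦ ?_⟩
  · rw [← sub_eq_zero]
    obtain ⟨z, hz⟩ := Ext.contravariant_sequence_exact₂ hS N (x - y) (by
      rw [sub_eq_add_neg, Ext.comp_add, Ext.comp_neg, ← sub_eq_add_neg, sub_eq_zero]
      exact hxy)
    rw [← hz, z.eq_zero_of_hasProjectiveDimensionLT (n + 1) hi, Ext.comp_zero]
  · exact Ext.contravariant_sequence_exact₁ hS N y (add_comm 1 i)
      (Ext.eq_zero_of_hasProjectiveDimensionLT _ (n + 1) (by lia))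

lemma hasProjectiveDimensionLT_of_extIso_f (hS : S.ShortExact) {n : ℕ} (h : ExtIso n S.f) :
    HasProjectiveDimensionLT S.X₃ (n + 2) := by
  rw [hasProjectiveDimensionLT_iff]
  intro i hi N x
  obtain ⟨i, rfl⟩ : ∃ j, i = 1 + j := ⟨i - 1, by lia⟩
  obtain ⟨x₁, rfl⟩ := Ext.contravariant_sequence_exact₃ hS N x (by
    apply (h (1 + i) (by lia) N).injective
    simp) rfl
  obtain ⟨x₂, rfl⟩ := (h i (by lia) N).surjective x₁
  simp

lemma extClass_comp_bijective (hS : S.ShortExact) [Projective S.X₂] (N : C) (i : ℕ) (hi : 0 < i) :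
    Function.Bijective fun x : Ext S.X₁ N i ↦ hS.extClass.comp x (add_comm 1 i) := by
  refine ⟨fun x y hxy ↦ ?_, fun y ↦ ?_⟩
  · rw [← sub_eq_zero]
    obtain ⟨z, hz⟩ := Ext.contravariant_sequence_exact₁ hS N (x - y) (add_comm 1 i) (by
      rw [sub_eq_add_neg, Ext.comp_add, Ext.comp_neg, ← sub_eq_add_neg, sub_eq_zero]
      exact hxy)
    rw [← hz, z.eq_zero_of_hasProjectiveDimensionLT 1 hi, Ext.comp_zero]
  · exact Ext.contravariant_sequence_exact₃ hS N y
      (Ext.eq_zero_of_hasProjectiveDimensionLT _ 1 (by lia)) (add_comm 1 i)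

end ShortExact

lemma extIso_τ₁_iff {S S' : ShortComplex C} (hS : S.ShortExact) (hS' : S'.ShortExact)
    [Projective S.X₂] [Projective S'.X₂] (φ : S ⟶ S') (n : ℕ) :
    ExtIso n φ.τ₁ ↔ ExtIso (n + 1) φ.τ₃ := by
  have key (i : ℕ) (hi : 0 < i) (N : C) :
      (Function.Bijective fun x : Ext S'.X₁ N i ↦ (Ext.mk₀ φ.τ₁).comp x (zero_add i)) ↔
        Function.Bijective fun x : Ext S'.X₃ N (i + 1) ↦
          (Ext.mk₀ φ.τ₃).comp x (zero_add (i + 1)) := by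
    rw [← Function.Bijective.of_comp_iff' (extClass_comp_bijective hS N i hi),
      ← Function.Bijective.of_comp_iff _ (extClass_comp_bijective hS' N i hi)]
    refine Eq.to_iff (congrArg Function.Bijective (funext fun x ↦ ?_))
    have h := ShortComplex.ShortExact.extClass_naturality hS hS' φ
    have h' := congrArg (fun y : Ext S.X₃ S'.X₁ 1 ↦ y.comp x (add_comm 1 i)) h
    dsimp only [Function.comp_apply] at h' ⊢
    rw [Ext.comp_assoc_of_second_deg_zero] at h'
    rw [h', Ext.comp_assoc (a₁₂ := 1) (a₂₃ := i + 1) _ _ _ (by lia) (by lia) (by lia)]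
  refine ⟨fun h i hi N ↦ ?_, fun h i hi N ↦ (key i (by lia) N).2 (h (i + 1) (by lia) N)⟩
  obtain ⟨i, rfl⟩ : ∃ j, i = j + 1 := ⟨i - 1, by lia⟩
  exact (key i (by lia) N).1 (h i (by lia) N)

lemma extIso_inl (A P : C) [Projective P] : ExtIso 0 (biprod.inl : A ⟶ A ⊞ P) := fun i hi N ↦ by
  refine ⟨fun x y hxy ↦ Ext.biprod_ext hxy ?_, fun y ↦
    ⟨(Ext.mk₀ biprod.fst).comp y (zero_add i), by simp⟩⟩
  rw [Ext.eq_zero_of_hasProjectiveDimensionLT ((Ext.mk₀ biprod.inr).comp x (zero_add i)) 1 hi,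
    Ext.eq_zero_of_hasProjectiveDimensionLT ((Ext.mk₀ biprod.inr).comp y (zero_add i)) 1 hi]

lemma extIso_fst (A P : C) [Projective P] : ExtIso 0 (biprod.fst : A ⊞ P ⟶ A) :=
  (extIso_inl A P).of_comp_left (by rw [biprod.inl_fst]; exact .of_isIso _ _)

lemma StablyIso.exists_extIso {A B : C} (h : StablyIso A B) : ∃ g : A ⟶ B, ExtIso 0 g := by
  obtain ⟨P, Q, hP, hQ, ⟨e⟩⟩ := h
  exact ⟨biprod.inl ≫ e.hom ≫ biprod.fst,
    (extIso_inl A P).comp ((ExtIso.of_isIso e.hom 0).comp (extIso_fst B Q))⟩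

lemma nonempty_splitting_of_extIso_g {S : ShortComplex C} (hS : S.ShortExact)
    (h : ExtIso 0 S.g) : Nonempty S.Splitting := by
  have h₀ : hS.extClass = 0 := by
    apply (h 1 one_pos _).injective
    exact hS.comp_extClass.trans (Ext.comp_zero _ _ _ _ _).symm
  obtain ⟨x, hx⟩ := Ext.contravariant_sequence_exact₁ hS S.X₁ (Ext.mk₀ (𝟙 S.X₁)) (add_zero 1)
    (by rw [h₀, Ext.zero_comp])
  obtain ⟨r, rfl⟩ := (Ext.mk₀_bijective _ _).surjective x
  rw [Ext.mk₀_comp_mk₀] at hx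
  exact ⟨.ofExactOfRetraction S hS.exact r ((Ext.mk₀_bijective _ _).injective hx) hS.epi_g⟩

lemma projective_X₁_of_extIso_g {S : ShortComplex C} (σ : S.Splitting) (h : ExtIso 0 S.g) :
    Projective S.X₁ := by
  rw [projective_iff_subsingleton_ext_one]
  refine fun N ↦ subsingleton_of_forall_eq 0 fun x ↦ ?_
  obtain ⟨z, hz : (Ext.mk₀ S.g).comp z (zero_add 1) = (Ext.mk₀ σ.r).comp x (zero_add 1)⟩ :=
    (h 1 one_pos N).surjective _
  calc x = (Ext.mk₀ S.f).comp ((Ext.mk₀ σ.r).comp x (zero_add 1)) (zero_add 1) := by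
        rw [Ext.mk₀_comp_mk₀_assoc, σ.f_r, Ext.mk₀_id_comp]
    _ = 0 := by rw [← hz, Ext.mk₀_comp_mk₀_assoc, S.zero, Ext.mk₀_zero, Ext.zero_comp]

lemma ExtIso.stablyIso [EnoughProjectives C] {A B : C} {g : A ⟶ B} (hg : ExtIso 0 g) :
    StablyIso A B := by
  let h : A ⊞ Projective.over B ⟶ B := biprod.desc g (Projective.π B)
  have : Epi h := epi_of_epi_fac (biprod.inr_desc g (Projective.π B))
  have hh : ExtIso 0 h := (extIso_inl A (Projective.over B)).of_comp_left
    (by rwa [biprod.inl_desc])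
  let S := ShortComplex.mk _ _ (kernel.condition h)
  have hS : S.ShortExact := { exact := ShortComplex.exact_kernel _ }
  obtain ⟨σ⟩ := nonempty_splitting_of_extIso_g hS hh
  exact ⟨Projective.over B, S.X₁, inferInstance, projective_X₁_of_extIso_g σ hh,
    ⟨σ.isoBinaryBiproduct ≪≫ biprod.braiding _ _⟩⟩

end ExtIso

section Stable

open Abelian ZeroObject

variable {C : Type u} [Category.{v} C] [Abelian C]

lemma shortExact_biprod {S S' : ShortComplex C} (hS : S.ShortExact) (hS' : S'.ShortExact) :
    (ShortComplex.mk (biprod.map S.f S'.f) (biprod.map S.g S'.g) (by ext <;> simp)).ShortExact := by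
  have := hS.mono_f
  have := hS'.mono_f
  have := hS.epi_g
  have := hS'.epi_g
  refine { exact := ShortComplex.exact_of_f_is_kernel _ ?_, mono_f := ?_, epi_g := ?_ }
  · refine KernelFork.IsLimit.ofι' _ _ fun {A} k hk ↦
      ⟨biprod.lift (hS.exact.lift (k ≫ biprod.fst) ?_) (hS'.exact.lift (k ≫ biprod.snd) ?_), ?_⟩
    · simpa using hk =≫ biprod.fst
    · simpa using hk =≫ biprod.snd
    · ext <;> simp
  · dsimp only; infer_instance
  · dsimp only; infer_instance

lemma exists_hom_of_shortExact {S S' : ShortComplex C}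
    (hS' : S'.ShortExact) [Projective S.X₂] (g : S.X₃ ⟶ S'.X₃) :
    ∃ φ : S ⟶ S', φ.τ₃ = g := by
  have := hS'.epi_g
  have := hS'.mono_f
  let τ₂ : S.X₂ ⟶ S'.X₂ := Projective.factorThru (S.g ≫ g) S'.g
  have h : τ₂ ≫ S'.g = S.g ≫ g := Projective.factorThru_comp _ _
  exact ⟨{ τ₁ := hS'.exact.lift (S.f ≫ τ₂) (by rw [Category.assoc, h, S.zero_assoc, zero_comp])
           τ₂ := τ₂
           τ₃ := g
           comm₁₂ := by simp
           comm₂₃ := h }, rfl⟩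

variable [EnoughProjectives C]

lemma StablyIso.of_iso {A B : C} (e : A ≅ B) : StablyIso A B :=
  let := HasExt.standard C
  (ExtIso.of_isIso e.hom 0).stablyIso

lemma StablyIso.trans {A B D : C} (h : StablyIso A B) (h' : StablyIso B D) : StablyIso A D := by
  let := HasExt.standard C
  obtain ⟨f, hf⟩ := h.exists_extIso
  obtain ⟨g, hg⟩ := h'.exists_extIso
  exact (hf.comp hg).stablyIso

lemma StablyIso.biprod {A B A' B' : C} (h : StablyIso A B) (h' : StablyIso A' B') :
    StablyIso (A ⊞ A') (B ⊞ B') := by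
  let := HasExt.standard C
  obtain ⟨f, hf⟩ := h.exists_extIso
  obtain ⟨g, hg⟩ := h'.exists_extIso
  exact (hf.biprod_map hg).stablyIso

lemma StablyIso.of_shortExact {S S' : ShortComplex C} (hS : S.ShortExact) (hS' : S'.ShortExact)
    [Projective S.X₂] [Projective S'.X₂] (h : StablyIso S.X₃ S'.X₃) : StablyIso S.X₁ S'.X₁ := by
  let := HasExt.standard C
  obtain ⟨g, hg⟩ := h.exists_extIso
  obtain ⟨φ, rfl⟩ := exists_hom_of_shortExact hS' g
  exact ((extIso_τ₁_iff hS hS' φ 0).2 (hg.mono (Nat.zero_le _))).stablyIso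

/-- The chosen projective presentation `0 ⟶ Ω X ⟶ P ⟶ X ⟶ 0`. -/
noncomputable def syzygyShortComplex (X : C) : ShortComplex C :=
  .mk _ _ (kernel.condition (Projective.π X))

/-- The chosen first syzygy of an object. -/
noncomputable abbrev syzygy (X : C) : C := (syzygyShortComplex X).X₁

lemma syzygyShortComplex_shortExact (X : C) : (syzygyShortComplex X).ShortExact where
  exact := ShortComplex.exact_kernel _
  mono_f := by dsimp only [syzygyShortComplex]; infer_instance
  epi_g := by dsimp only [syzygyShortComplex]; infer_instance

instance (X : C) : Projective (syzygyShortComplex X).X₂ := by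
  dsimp only [syzygyShortComplex]; infer_instance

protected lemma StablyIso.syzygy {A B : C} (h : StablyIso A B) : StablyIso (syzygy A) (syzygy B) :=
  .of_shortExact (syzygyShortComplex_shortExact A) (syzygyShortComplex_shortExact B) h

lemma stablyIso_syzygy_biprod (A B : C) : StablyIso (syzygy (A ⊞ B)) (syzygy A ⊞ syzygy B) := by
  have : Projective ((syzygyShortComplex A).X₂ ⊞ (syzygyShortComplex B).X₂) := inferInstance
  exact .of_shortExact (syzygyShortComplex_shortExact (A ⊞ B))
    (shortExact_biprod (syzygyShortComplex_shortExact A) (syzygyShortComplex_shortExact B))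
    (.of_iso (Iso.refl (A ⊞ B)))

lemma exists_iterate_syzygy_hom [HasExt.{w} C] {A B : C} (g : A ⟶ B) (n : ℕ) :
    ∃ g' : syzygy^[n] A ⟶ syzygy^[n] B,
      ∀ k, ExtIso k g' ↔ ExtIso (k + n) g := by
  induction n generalizing A B with
  | zero => exact ⟨g, fun k ↦ Iff.rfl⟩
  | succ n ih =>
    obtain ⟨φ, hφ⟩ := exists_hom_of_shortExact
      (syzygyShortComplex_shortExact B) (S := syzygyShortComplex A) g
    obtain ⟨g', hg'⟩ := ih φ.τ₁
    refine ⟨g', fun k ↦ (hg' k).trans ?_⟩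
    rw [extIso_τ₁_iff (syzygyShortComplex_shortExact A) (syzygyShortComplex_shortExact B), hφ]
    rfl

lemma projective_syzygy {X : C} (hX : IsZero X) : Projective (syzygy X) := by
  have hS := syzygyShortComplex_shortExact X
  have : IsIso (syzygyShortComplex X).f := hS.isIso_f_iff.2 hX
  exact Projective.of_iso (asIso (syzygyShortComplex X).f).symm inferInstance

variable (C) in
/-- The setoid of stably isomorphic objects. -/
def stablyIsoSetoid : Setoid C where
  r := StablyIso
  iseqv := ⟨fun X ↦ .of_iso (Iso.refl X), StablyIso.symm, StablyIso.trans⟩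

variable (C) in
/-- The commutative monoid of stable isomorphism classes of objects. -/
def StableClass : Type u := _root_.Quotient (stablyIsoSetoid C)

namespace StableClass

/-- The stable isomorphism class of an object. -/
def mk (X : C) : StableClass C := _root_.Quotient.mk (stablyIsoSetoid C) X

lemma mk_eq_mk_iff {X Y : C} : mk X = mk Y ↔ StablyIso X Y :=
  _root_.Quotient.eq (r := stablyIsoSetoid C)

lemma ind {P : StableClass C → Prop} (h : ∀ X, P (mk X)) (x : StableClass C) : P x :=
  _root_.Quotient.ind h x

noncomputable instance : Add (StableClass C) :=
  ⟨_root_.Quotient.map₂ (fun X Y ↦ X ⊞ Y) fun _ _ h _ _ h' ↦ h.biprod h'⟩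

noncomputable instance : Zero (StableClass C) := ⟨mk 0⟩

lemma mk_biprod (X Y : C) : mk (X ⊞ Y) = mk X + mk Y := rfl

lemma mk_eq_zero_of_projective {X : C} (hX : Projective X) : mk X = 0 :=
  mk_eq_mk_iff.2 ⟨0, X, inferInstance, hX, ⟨biprod.braiding X 0⟩⟩

noncomputable instance : AddCommMonoid (StableClass C) where
  add_assoc a b c := by
    induction a using ind
    induction b using ind
    induction c using ind
    exact mk_eq_mk_iff.2 (.of_iso (biprod.associator _ _ _))
  zero_add a := by
    induction a using ind
    exact mk_eq_mk_iff.2 (.of_iso (isoZeroBiprod (isZero_zero C)).symm)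
  add_zero a := by
    induction a using ind
    exact mk_eq_mk_iff.2 (.of_iso (isoBiprodZero (isZero_zero C)).symm)
  add_comm a b := by
    induction a using ind
    induction b using ind
    exact mk_eq_mk_iff.2 (.of_iso (biprod.braiding _ _))
  nsmul := nsmulRec

/-- The endomorphism of the monoid of stable classes induced by taking syzygies. -/
noncomputable def syzygyHom : StableClass C →+ StableClass C where
  toFun := _root_.Quotient.map syzygy fun _ _ h ↦ h.syzygy
  map_zero' := mk_eq_zero_of_projective (projective_syzygy (isZero_zero C))
  map_add' a b := by
    induction a using ind
    induction b using ind
    exact mk_eq_mk_iff.2 (stablyIso_syzygy_biprod _ _)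

lemma iterate_syzygyHom_mk (X : C) (n : ℕ) :
    syzygyHom^[n] (mk X) = mk (syzygy^[n] X) := by
  induction n generalizing X with
  | zero => rfl
  | succ _ ih => exact ih (syzygy X)

end StableClass

end Stable

section Monoid

lemma wellFoundedGT_addCon (A : Type*) [AddCommMonoid A] [AddMonoid.FG A] :
    WellFoundedGT (AddCon A) := by
  -- Rédei's theorem: a congruence `c` is determined by the kernel of `ℤ[A] → ℤ[A / c]`, an ideal of
  -- a noetherian ring.
  have : IsNoetherianRing (AddMonoidAlgebra ℤ A) := Algebra.FiniteType.isNoetherianRing ℤ _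
  let I (c : AddCon A) : Ideal (AddMonoidAlgebra ℤ A) :=
    RingHom.ker (AddMonoidAlgebra.mapDomainRingHom ℤ c.mk')
  have hI (c : AddCon A) (x y : A) : .single x 1 - .single y 1 ∈ I c ↔ c x y := by
    rw [RingHom.mem_ker, map_sub, sub_eq_zero]
    simp [AddMonoidAlgebra.single_left_inj]
  have hI_le {c d : AddCon A} : I c ≤ I d ↔ c ≤ d := by
    refine ⟨fun h x y hxy ↦ (hI d x y).1 (h ((hI c x y).2 hxy)), fun h x hx ↦ ?_⟩
    rw [RingHom.mem_ker] at hx ⊢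
    rw [show d.mk' = (c.map d h).comp c.mk' from rfl, AddMonoidAlgebra.mapDomainRingHom_comp,
      RingHom.comp_apply, hx, map_zero]
  exact (OrderEmbedding.ofMapLEIff I fun _ _ ↦ hI_le).strictMono.wellFoundedGT

lemma exists_iterate_eq_of_finite {M : Type*} [AddCommMonoid M] (φ : M →+ M) {F : Set M}
    (hF : F.Finite) :
    ∃ n : ℕ, ∀ x ∈ AddSubmonoid.closure F, ∀ y ∈ AddSubmonoid.closure F, ∀ r : ℕ,
      φ^[r] x = φ^[r] y → φ^[n] x = φ^[n] y := by
  let A := AddSubmonoid.closure F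
  have : AddMonoid.FG A := (AddMonoid.fg_iff_addSubmonoid_fg A).2 ⟨hF.toFinset, by simp [A]⟩
  have := wellFoundedGT_addCon A
  let Φ : AddMonoid.End M := φ
  let c : ℕ →o AddCon A :=
    { toFun r := AddCon.ker (AddMonoidHom.comp (Φ ^ r) A.subtype)
      monotone' := monotone_nat_of_le_succ fun r x y (h : φ^[r] x = φ^[r] y) ↦ by
        change φ^[r + 1] x = φ^[r + 1] y
        rw [Function.iterate_succ_apply', h, Function.iterate_succ_apply'] }
  obtain ⟨n, hn⟩ := WellFoundedGT.monotone_chain_condition c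
  refine ⟨n, fun x hx y hy r (h : c r ⟨x, hx⟩ ⟨y, hy⟩) ↦ ?_⟩
  have h' : c (max n r) ⟨x, hx⟩ ⟨y, hy⟩ := c.monotone (le_max_right n r) h
  rwa [← hn _ (le_max_left n r)] at h'

end Monoid

section IgusaTodorov

open Abelian ZeroObject

variable {C : Type u} [Category.{v} C] [Abelian C]

lemma hasProjectiveDimensionLT_of_retract_isLocalRing [HasFittingDecompositions C] (Z : C) (n : ℕ)
    (h : ∀ W, IsLocalRing (End W) → Nonempty (Retract W Z) → HasProjectiveDimensionLT W n) :
    HasProjectiveDimensionLT Z n := by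
  let P : ObjectProperty C := fun Z ↦ (∀ W, IsLocalRing (End W) → Nonempty (Retract W Z) →
    HasProjectiveDimensionLT W n) → HasProjectiveDimensionLT Z n
  have : P.IsClosedUnderIsomorphisms := ⟨fun e h h' ↦
    have := h fun W hW ⟨r⟩ ↦ h' W hW ⟨r.trans e.retract⟩
    hasProjectiveDimensionLT_of_iso e n⟩
  refine krullSchmidt_induction P (fun X hX _ ↦ ?_) (fun X hX h ↦ h X hX ⟨.refl X⟩)
    (fun X Y hX hY h ↦ ?_) Z h
  · have := hX.hasProjectiveDimensionLT_zero
    exact hasProjectiveDimensionLT_of_ge X 0 n (Nat.zero_le n)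
  · have h₁ := hX fun W hW ⟨r⟩ ↦ h W hW ⟨r.trans ⟨biprod.inl, biprod.fst, biprod.inl_fst⟩⟩
    have h₂ := hY fun W hW ⟨r⟩ ↦ h W hW ⟨r.trans ⟨biprod.inr, biprod.snd, biprod.inr_snd⟩⟩
    infer_instance

lemma StablyIso.projective_or_retract {X Y W : C} [IsLocalRing (End W)] (h : StablyIso X Y)
    (r : Retract W X) : Projective W ∨ Nonempty (Retract W Y) := by
  obtain ⟨P, Q, _, _, ⟨e⟩⟩ := h
  have r' : Retract W (Y ⊞ Q) :=
    (r.trans ⟨biprod.inl, biprod.fst, biprod.inl_fst⟩).trans e.retract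
  exact (retract_or_retract_of_retract_biprod r').symm.imp_left fun ⟨r''⟩ ↦ r''.projective

lemma exists_bound_of_finite {G : Set C} (hG : G.Finite) :
    ∃ q : ℕ, ∀ U ∈ G, (∃ m, HasProjectiveDimensionLT U m) → HasProjectiveDimensionLT U q := by
  choose! d hd using fun (U : C) (h : ∃ m, HasProjectiveDimensionLT U m) ↦ h
  obtain ⟨q, hq⟩ := (hG.image d).bddAbove
  refine ⟨q, fun U hU hU' ↦ ?_⟩
  have := hd U hU'
  exact hasProjectiveDimensionLT_of_ge U (d U) q (hq ⟨U, hU, rfl⟩)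

lemma extIso_of_end [HasFittingDecompositions C] [HasExt.{w} C] {X : C} {f : X ⟶ X} {m q : ℕ}
    (hf : ExtIso m f) (hX : ∀ Z, Nonempty (Retract Z X) → (∃ m, HasProjectiveDimensionLT Z m) →
      HasProjectiveDimensionLT Z (q + 1)) : ExtIso q f := by
  obtain ⟨Y, Z, e, u, z, hu, hz, rfl⟩ := HasFittingDecompositions.exists_fitting f
  have huz : ExtIso m (biprod.map u z) :=
    (ExtIso.of_isIso e.inv m).of_comp_right ((ExtIso.of_isIso e.hom m).of_comp_left hf)
  have hZ := hX Z ⟨.trans ⟨biprod.inr, biprod.snd, biprod.inr_snd⟩ e.symm.retract⟩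
    ⟨m + 1, huz.biprod_snd.hasProjectiveDimensionLT_of_isNilpotent hz⟩
  exact (ExtIso.of_isIso e.hom q).comp (((ExtIso.of_isIso u q).biprod_map
    (ExtIso.of_hasProjectiveDimensionLT z q)).comp (ExtIso.of_isIso e.inv q))

variable [EnoughProjectives C]

namespace StableClass

attribute [local instance] Abelian.hasFiniteBiproducts in
lemma exists_finite_of_addClosure [HasFittingDecompositions C] (V : C) :
    ∃ F : Set C, F.Finite ∧ ∀ X, addClosure V X → mk X ∈ AddSubmonoid.closure (mk '' F) := by
  obtain ⟨F, hF, hFV⟩ := exists_finite_of_retract V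
  have hV {X Y : C} (r : Retract X Y) : addClosure V Y → addClosure V X :=
    fun ⟨m, ⟨s⟩⟩ ↦ ⟨m, ⟨r.trans s⟩⟩
  let P : ObjectProperty C := fun X ↦ addClosure V X → mk X ∈ AddSubmonoid.closure (mk '' F)
  have : P.IsClosedUnderIsomorphisms := ⟨fun e h hX ↦
    mk_eq_mk_iff.2 (.of_iso e) ▸ h (hV e.retract hX)⟩
  refine ⟨F, hF, krullSchmidt_induction P (fun X hX _ ↦ ?_) (fun W hW hWV ↦ ?_)
    (fun X Y hX hY hXY ↦ ?_)⟩
  · rw [mk_eq_zero_of_projective hX.projective]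
    exact zero_mem _
  · obtain ⟨_, ⟨r⟩⟩ := hWV
    obtain ⟨_, hj⟩ := exists_retract_of_retract_biproduct r
    obtain ⟨U, hU, ⟨e⟩⟩ := hFV W hW hj
    rw [mk_eq_mk_iff.2 (.of_iso e)]
    exact AddSubmonoid.subset_closure ⟨U, hU, rfl⟩
  · rw [mk_biprod]
    exact add_mem
      (hX (hV ⟨biprod.inl, biprod.fst, biprod.inl_fst⟩ hXY))
      (hY (hV ⟨biprod.inr, biprod.snd, biprod.inr_snd⟩ hXY))

lemma projective_or_exists_retract {G : Set C} {Y : C}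
    (hY : mk Y ∈ AddSubmonoid.closure (mk '' G)) {W : C} [IsLocalRing (End W)] (r : Retract W Y) :
    Projective W ∨ ∃ U ∈ G, Nonempty (Retract W U) := by
  generalize hy : mk Y = y at hY
  induction hY using AddSubmonoid.closure_induction generalizing Y with
  | mem y hyG =>
    obtain ⟨U, hU, rfl⟩ := hyG
    exact ((mk_eq_mk_iff.1 hy).projective_or_retract r).imp_right fun h ↦ ⟨U, hU, h⟩
  | zero => exact .inl <|
      ((mk_eq_mk_iff.1 hy).projective_or_retract r).elim id fun ⟨r'⟩ ↦ r'.projective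
  | add a b _ _ iha ihb =>
    induction a using ind with | h A
    induction b using ind with | h B
    rcases (mk_eq_mk_iff.1 (hy.trans (mk_biprod A B).symm)).projective_or_retract r with h | ⟨⟨r'⟩⟩
    · exact .inl h
    · rcases retract_or_retract_of_retract_biprod r' with ⟨⟨r₁⟩⟩ | ⟨⟨r₂⟩⟩
      · exact iha r₁ rfl
      · exact ihb r₂ rfl

lemma exists_bound_of_retract [HasFittingDecompositions C] {G : Set C} (hG : G.Finite) :
    ∃ q : ℕ, ∀ Y Z : C, mk Y ∈ AddSubmonoid.closure (mk '' G) → Nonempty (Retract Z Y) →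
      (∃ m, HasProjectiveDimensionLT Z m) → HasProjectiveDimensionLT Z (q + 1) := by
  choose L hL hLG using fun U : C ↦ exists_finite_of_retract U
  obtain ⟨q, hq⟩ := exists_bound_of_finite (hG.biUnion fun U _ ↦ hL U)
  refine ⟨q, fun Y Z hY ⟨r⟩ ⟨m, hm⟩ ↦
    hasProjectiveDimensionLT_of_retract_isLocalRing Z (q + 1) fun W hW ⟨s⟩ ↦ ?_⟩
  rcases projective_or_exists_retract hY (s.trans r) with h | ⟨U, hU, hWU⟩
  · exact hasProjectiveDimensionLT_of_ge W 1 _ (by lia)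
  · obtain ⟨U', hU', ⟨e⟩⟩ := hLG U W hW hWU
    have := s.hasProjectiveDimensionLT m
    have := hq U' (Set.mem_biUnion hU hU') ⟨m, hasProjectiveDimensionLT_of_iso e m⟩
    have := hasProjectiveDimensionLT_of_iso e.symm q
    exact hasProjectiveDimensionLT_of_ge W q _ (by lia)

lemma mk_iterate_syzygy_mem_closure {F : Set C} (n : ℕ) {X : C}
    (hX : mk X ∈ AddSubmonoid.closure (mk '' F)) :
    mk (syzygy^[n] X) ∈ AddSubmonoid.closure (mk '' (syzygy^[n] '' F)) := by
  rw [← iterate_syzygyHom_mk]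
  generalize mk X = x at hX ⊢
  induction hX using AddSubmonoid.closure_induction with
  | mem x hx =>
    obtain ⟨U, hU, rfl⟩ := hx
    exact AddSubmonoid.subset_closure ⟨_, ⟨U, hU, rfl⟩, (iterate_syzygyHom_mk U n).symm⟩
  | zero => rw [iterate_map_zero]; exact zero_mem _
  | add x y _ _ hx hy => rw [iterate_map_add]; exact add_mem hx hy

lemma iterate_syzygyHom_eq_of_extIso [HasExt.{w} C] {X Y : C} {f : X ⟶ Y} {k : ℕ}
    (hf : ExtIso k f) : syzygyHom^[k] (mk X) = syzygyHom^[k] (mk Y) := by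
  obtain ⟨f', hf'⟩ := exists_iterate_syzygy_hom f k
  rw [iterate_syzygyHom_mk, iterate_syzygyHom_mk, mk_eq_mk_iff]
  exact ((hf' 0).2 (by rwa [zero_add])).stablyIso

end StableClass

open StableClass in
attribute [local instance] Abelian.hasFiniteBiproducts in
theorem exists_bound_of_addClosure [HasFittingDecompositions C] (V : C) :
    ∃ N : ℕ, ∀ S : ShortComplex C, S.ShortExact → addClosure V S.X₁ → addClosure V S.X₂ →
      (∃ m, HasProjectiveDimensionLT S.X₃ m) → HasProjectiveDimensionLT S.X₃ N := by
  let := HasExt.standard C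
  obtain ⟨F, hF, hFV⟩ := exists_finite_of_addClosure V
  obtain ⟨n, hn⟩ := exists_iterate_eq_of_finite (syzygyHom (C := C)) (hF.image mk)
  obtain ⟨q, hq⟩ := exists_bound_of_retract (hF.image syzygy^[n])
  refine ⟨q + n + 2, fun S hS h₁ h₂ ⟨m, hm⟩ ↦ hasProjectiveDimensionLT_of_extIso_f hS ?_⟩
  have hf : ExtIso (m + n) S.f :=
    have : HasProjectiveDimensionLT S.X₃ (m + n + 1) :=
      hasProjectiveDimensionLT_of_ge S.X₃ m _ (by lia)
    extIso_f_of_shortExact hS (m + n)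
  have hst : StablyIso (syzygy^[n] S.X₂) (syzygy^[n] S.X₁) := by
    rw [← mk_eq_mk_iff, ← iterate_syzygyHom_mk, ← iterate_syzygyHom_mk]
    exact (hn _ (hFV _ h₁) _ (hFV _ h₂) _ (iterate_syzygyHom_eq_of_extIso hf)).symm
  obtain ⟨f', hf'⟩ := exists_iterate_syzygy_hom S.f n
  obtain ⟨s, hs⟩ := hst.exists_extIso
  rw [← hf']
  exact (hs.mono (Nat.zero_le q)).of_comp_right
    (extIso_of_end (((hf' m).2 hf).comp (hs.mono (Nat.zero_le m))) fun Z ↦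
      hq _ Z (mk_iterate_syzygy_mem_closure n (hFV _ h₁)))

end IgusaTodorov

section Fitting

lemma exists_isCompl_bijective_isNilpotent {R M : Type*} [Ring R] [AddCommGroup M] [Module R M]
    [IsArtinian R M] [IsNoetherian R M] (φ : Module.End R M) :
    ∃ (p q : Submodule R M) (hp : ∀ x ∈ p, φ x ∈ p) (hq : ∀ x ∈ q, φ x ∈ q), IsCompl p q ∧
      Function.Bijective (φ.restrict hp) ∧ IsNilpotent (φ.restrict hq) := by
  obtain ⟨n, hn, hn₀⟩ :=
    (φ.eventually_isCompl_ker_pow_range_pow.and (Filter.eventually_gt_atTop 0)).exists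
  have hcomm (x : M) : φ ((φ ^ n) x) = (φ ^ n) (φ x) := by
    rw [← Module.End.mul_apply, ← Module.End.mul_apply, (Commute.self_pow φ n).eq]
  have hp : ∀ x ∈ LinearMap.range (φ ^ n), φ x ∈ LinearMap.range (φ ^ n) := by
    rintro _ ⟨x, rfl⟩
    exact ⟨φ x, (hcomm x).symm⟩
  have hq : ∀ x ∈ LinearMap.ker (φ ^ n), φ x ∈ LinearMap.ker (φ ^ n) := fun x hx ↦ by
    rw [LinearMap.mem_ker, ← hcomm, LinearMap.mem_ker.1 hx, map_zero]
  refine ⟨_, _, hp, hq, hn.symm, IsArtinian.bijective_of_injective_endomorphism _ ?_, n, ?_⟩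
  · refine (injective_iff_map_eq_zero _).2 fun ⟨x, hx⟩ h ↦ Subtype.ext ?_
    have hφx : φ x = 0 := congrArg Subtype.val h
    have hx' : x ∈ LinearMap.ker (φ ^ n) := by
      rw [LinearMap.mem_ker, ← Nat.sub_add_cancel hn₀, pow_succ, Module.End.mul_apply, hφx,
        map_zero]
    exact Submodule.disjoint_def.1 hn.disjoint x hx' hx
  · ext ⟨x, hx⟩
    rw [Module.End.pow_restrict]
    exact hx

variable {R : Type u} [Ring R] [IsNoetherianRing R]

open FGModuleCat

lemma exists_iso_biprod_of_isCompl {X : FGModuleCat.{u} R} {p q : Submodule R X}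
    (h : IsCompl p q) : ∃ e : X ≅ of R p ⊞ of R q,
      biprod.inl ≫ e.inv = ofHom p.subtype ∧ biprod.inr ≫ e.inv = ofHom q.subtype := by
  let b : BinaryBicone (of R p) (of R q) :=
    { pt := X
      fst := ofHom (p.projectionOnto q h)
      snd := ofHom (q.projectionOnto p h.symm)
      inl := ofHom p.subtype
      inr := ofHom q.subtype
      inl_fst := by ext x; exact congrArg Subtype.val (p.projectionOnto_apply_left h x)
      inl_snd := by ext x; exact congrArg Subtype.val (q.projectionOnto_apply_right h.symm x)
      inr_fst := by ext x; exact congrArg Subtype.val (p.projectionOnto_apply_right h x)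
      inr_snd := by ext x; exact congrArg Subtype.val (q.projectionOnto_apply_left h.symm x) }
  have hb : b.IsBilimit := isBinaryBilimitOfTotal b <| by
    ext x
    exact Submodule.projection_add_projection_eq_self h x
  exact ⟨biprod.uniqueUpToIso _ _ hb, biprod.inl_desc _ _, biprod.inr_desc _ _⟩

lemma length_eq_add_of_shortExact {S : ShortComplex (FGModuleCat.{u} R)} (hS : S.ShortExact) :
    Module.length R S.X₂ = Module.length R S.X₁ + Module.length R S.X₃ :=
  have hS' := hS.map_of_exact (forget₂ _ (ModuleCat.{u} R))
  Module.length_eq_add_of_exact S.f.hom.hom S.g.hom.hom hS'.moduleCat_injective_f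
    hS'.moduleCat_surjective_g
    ((ShortComplex.ShortExact.moduleCat_exact_iff_function_exact _).1 hS'.exact)

instance [IsArtinianRing R] : HasFittingDecompositions (FGModuleCat.{u} R) where
  exists_length := by
    refine ⟨fun X ↦ (Module.length R X).toNat, fun X hX ↦ ?_, fun {X Y Z} e ↦ ?_⟩
    · have : Subsingleton X := Module.length_eq_zero_iff.1 <|
        (ENat.toNat_eq_zero.1 hX).resolve_right Module.length_ne_top
      exact (IsZero.iff_id_eq_zero X).2 (by ext x; exact Subsingleton.elim _ _)
    · have h := (isoToLinearEquiv e).length_eq.trans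
        (length_eq_add_of_shortExact (ShortComplex.Splitting.ofHasBinaryBiproduct Y Z).shortExact)
      exact (congrArg ENat.toNat h).trans
        (ENat.toNat_add Module.length_ne_top Module.length_ne_top)
  exists_fitting {X} f := by
    obtain ⟨p, q, hp, hq, hpq, hu, n, hz⟩ := exists_isCompl_bijective_isNilpotent f.hom.hom
    obtain ⟨e, hl, hr⟩ := exists_iso_biprod_of_isCompl hpq
    refine ⟨of R p, of R q, e, ofHom (f.hom.hom.restrict hp), ofHom (f.hom.hom.restrict hq),
      (LinearEquiv.ofBijective _ hu).toFGModuleCatIso.isIso_hom, ⟨n, ?_⟩, ?_⟩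
    · have hpow (k : ℕ) : (End.of (ofHom (f.hom.hom.restrict hq)) ^ k : End (of R q)) =
          End.of (ofHom (f.hom.hom.restrict hq ^ k)) := by
        induction k with
        | zero => rfl
        | succ k ih => rw [pow_succ, ih]; rfl
      rw [hpow, hz]
      rfl
    · rw [← Iso.inv_comp_eq]
      apply biprod.hom_ext'
      · rw [reassoc_of% hl, biprod.inl_map_assoc, hl]
        rfl
      · rw [reassoc_of% hr, biprod.inr_map_assoc, hr]
        rfl

end Fitting

section IgusaTodorovAlgebras

variable {R : Type u} [Ring R]

lemma isArtinianRing_of_isArtinAlgebra [h : IsArtinAlgebra R] : IsArtinianRing R := by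
  obtain ⟨k, _, _, _, _⟩ := h.exists_base
  exact isArtinian_of_tower k inferInstance

variable [IsNoetherianRing R]

lemma IsSyzygy.hasProjectiveDimensionLT_iff {n : ℕ} {M K : FGModuleCat.{u} R}
    (h : IsSyzygy R n M K) (m : ℕ) :
    HasProjectiveDimensionLT M (m + 1 + n) ↔ HasProjectiveDimensionLT K (m + 1) := by
  induction n generalizing M with
  | zero =>
    obtain ⟨e⟩ := h
    exact ⟨fun _ ↦ hasProjectiveDimensionLT_of_iso e.symm _,
      fun _ ↦ hasProjectiveDimensionLT_of_iso e _⟩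
  | succ n ih =>
    obtain ⟨S, hS, hP, ⟨e⟩, h⟩ := h
    rw [← ih h]
    have := hS.hasProjectiveDimensionLT_X₃_iff (m + n) ((projective_iff _).2 hP)
    rw [show m + 1 + n = m + n + 1 by lia, ← this, show m + 1 + (n + 1) = m + n + 2 by lia]
    exact ⟨fun _ ↦ hasProjectiveDimensionLT_of_iso e.symm _,
      fun _ ↦ hasProjectiveDimensionLT_of_iso e _⟩

theorem IsIgusaTodorov.finitisticDimensionConjecture [IsArtinianRing R] (h : IsIgusaTodorov R) :
    FinitisticDimensionConjecture R := by
  obtain ⟨n, V, hV⟩ := h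
  obtain ⟨N, hN⟩ := exists_bound_of_addClosure V
  refine (finitisticDimensionConjecture_iff R).2 ⟨N + n, fun M ⟨m, hm⟩ ↦ ?_⟩
  obtain ⟨K, P, S, hK, hP, hS, h₁, h₂, ⟨e⟩⟩ := hV M
  have hKm : HasProjectiveDimensionLT K (m + 1) :=
    (hK.hasProjectiveDimensionLT_iff m).1 (hasProjectiveDimensionLT_of_ge M m _ (by lia))
  have : Projective P := (projective_iff P).2 hP
  have hPm : HasProjectiveDimensionLT P (m + 1) := hasProjectiveDimensionLT_of_ge P 1 _ (by lia)
  have : HasProjectiveDimensionLT S.X₃ N :=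
    hN S hS h₁ h₂ ⟨m + 1, hasProjectiveDimensionLT_of_iso e.symm (m + 1)⟩
  have hKN : HasProjectiveDimensionLT K N :=
    (Retract.trans ⟨biprod.inl, biprod.fst, biprod.inl_fst⟩ e.symm.retract :
      Retract K S.X₃).hasProjectiveDimensionLT N
  rw [show N + n + 1 = N + 1 + n by lia, hK.hasProjectiveDimensionLT_iff]
  exact hasProjectiveDimensionLT_of_ge K N _ (by lia)

end IgusaTodorovAlgebras

end WakamatsuSilting

theorem theorem3p7_general (R : Type u) [Ring R] [IsNoetherianRing R]
    [HasDerivedCategory.{w} (FGModuleCat.{u} R)] :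
    (injectiveDimension (ModuleCat.of R R) ≠ ⊤ →
      WakamatsuSilting.FinitisticDimensionConjecture R) ∧
    (IsArtinianRing R → WakamatsuSilting.IsIgusaTodorov R →
      WakamatsuSilting.FinitisticDimensionConjecture R) ∧
    (WakamatsuSilting.FinitisticDimensionConjecture R →
      ∀ T : DerivedCategory (FGModuleCat.{u} R),
        WakamatsuSilting.perfect R T → WakamatsuSilting.IsWakamatsuSilting T →
          WakamatsuSilting.IsSilting T) :=
  ⟨WakamatsuSilting.finitisticDimensionConjecture_of_injectiveDimension_ne_top,
    fun _ ↦ WakamatsuSilting.IsIgusaTodorov.finitisticDimensionConjecture,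
    fun hR _ ↦ WakamatsuSilting.isSilting_of_isWakamatsuSilting hR⟩

theorem theorem3p7 (R : Type u) [Ring R] [IsArtinAlgebra R]
    [HasDerivedCategory.{w} (FGModuleCat.{u} R)] :
    -- the two families of examples satisfy the finitistic dimension conjecture
    (injectiveDimension (ModuleCat.of R R) ≠ ⊤ →
      WakamatsuSilting.FinitisticDimensionConjecture R) ∧
    (WakamatsuSilting.IsIgusaTodorov R →
      WakamatsuSilting.FinitisticDimensionConjecture R) ∧
    -- under the conjecture, compact Wakamatsu-silting complexes are silting
    (WakamatsuSilting.FinitisticDimensionConjecture R →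
      ∀ T : DerivedCategory (FGModuleCat.{u} R),
        WakamatsuSilting.perfect R T → WakamatsuSilting.IsWakamatsuSilting T →
          WakamatsuSilting.IsSilting T) :=
  have h := theorem3p7_general R
  ⟨h.1, h.2.1 WakamatsuSilting.isArtinianRing_of_isArtinAlgebra, h.2.2⟩
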